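/- Let $\sigma$ be a primitive substitution over a finite alphabet $A$ (a non-erasing morphism of $A^*$), with incidence matrix $M=M_\sigma=(|\sigma(a)|_b)_{(b,a)\in A^2}$ (some power of $M$ has only positive entries). Assume that the Perron eigenvalue $\beta$ of $M$ is a Pisot number and an algebraic unit, of degree $d+1$, with minimal polynomial $\pi_\beta$. Let $\Omega_\sigma\subseteq A^{\mathbb Z}$ be the subshift of $\sigma$, i.e. the smallest non-empty compact subset invariant under the shift $S$ and under $\sigma$, and let $u\in\Omega_\sigma$ be a fixed point of $\sigma$. For a finite word $w$ let $\mathrm{ab}(w)=(|w|_a)_{a\in A}\in\mathbb R^A$; for $v\in A^{\mathbb Z}$ and $n\ge 0$ put $v_{[0,n)}=v_0\cdots v_{n-1}$, and for $n<0$ put $\mathrm{ab}(v_{[0,n)})=-\mathrm{ab}(v_n\cdots v_{-1})$; the worm of $v$ is $W(v)=\{\mathrm{ab}(v_{[0,n)}) : n\in\mathbb Z\}$. Let $P\in\mathbb Z[X]$ be such that the characteristic polynomial of $M$ is $\pi_\beta P$, and let $V:\mathbb R^A\to\mathbb R^d$ be a linear map with kernel $F=\ker\big((M-\beta I)P(M)\big)$,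 where $d+\dim F=|A|$. Then the map $S^nu\mapsto V\,\mathrm{ab}(u_{[0,n)})$ $(n\in\mathbb Z)$ is well defined on the orbit of $u$ and extends continuously to a map $\phi:\Omega_\sigma\to\mathbb R^d$ (unique, the orbit being dense). For $a\in A$ put $R_a=\phi(\{v\in\Omega_\sigma : v_0=a\})$, and write $b\xrightarrow{t}a$ if $\sigma(b)=p\,a\,s$ for some words $p,s$ with $\mathrm{ab}(p)=t$. The following hold. 1. There is a unique endomorphism $N$ of $\mathbb R^d$ with $NV=VM$; it is invertible, and $|\det N|=1/\beta$. 2. For every $a\in A$, $R_a=\bigcup_{b\xrightarrow{t}a}(N R_b+Vt)$, and the union is disjoint in Lebesgue measure: the sets $NR_b+Vt$ and $NR_{b'}+Vt'$ for two different transitions $(b,t)\ne(b',t')$ to $a$ meet in a set of Lebesgue measure zero. 3. For every $v\in A^{\mathbb Z}$, the restriction of $V$ to $W(v)$ is injective. 4. Each $R_a$ is the closure of its interior. 5. The boundary of each $R_a$ has Lebesgue measure zero. -/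

import Mathlib

open MeasureTheory Topology Filter Polynomial

namespace RauzyFractal

/-- A substitution over `A`: a non-erasing morphism of the free monoid of finite words, given by
the images of the letters. -/
structure Substitution (A : Type*) where
  /-- the image `σ(a)` of a letter -/
  image : A → List A
  /-- every letter has a non-empty image -/
  nonerasing : ∀ a, image a ≠ []

/-- The finite word `u_m u_{m+1} ⋯ u_{m+n-1}` of a bi-infinite word `u`. -/
def factor {A : Type*} (u : ℤ → A) (m : ℤ) (n : ℕ) : List A :=
  (List.range n).map fun i : ℕ => u (m + (i : ℤ))

/-- The `n`-th power `S^n` (`n ∈ ℤ`) of the shift map `S : (u_i) ↦ (u_{i+1})`. -/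
def shiftPow {A : Type*} (n : ℤ) (u : ℤ → A) : ℤ → A := fun i => u (i + n)

namespace Substitution

/-- The image `σ(w)` of a finite word. -/
def onWord {A : Type*} (σ : Substitution A) (w : List A) : List A := w.flatMap σ.image

theorem length_le_onWord {A : Type*} (σ : Substitution A) (w : List A) :
    w.length ≤ (σ.onWord w).length := by
  induction w with
  | nil => simp
  | cons a w ih =>
    have h := List.length_pos_of_ne_nil (σ.nonerasing a)
    simp only [onWord, List.flatMap_cons, List.length_append, List.length_cons] at *
    omega

theorem lt_length_onWord_factor {A : Type*} (σ : Substitution A) (u : ℤ → A) (m : ℤ) (k : ℕ) :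
    k < (σ.onWord (factor u m (k + 1))).length := by
  have h := σ.length_le_onWord (factor u m (k + 1))
  simp only [factor, List.length_map, List.length_range] at *
  omega

/-- The image `σ(u) = ⋯ σ(u_{-2}) σ(u_{-1}) · σ(u_0) σ(u_1) ⋯` of a bi-infinite word: the letter of
index `k ≥ 0` is the letter of index `k` of the word `σ(u_0 ⋯ u_k)`, and the letter of index `-k`,
with `k ≥ 1`, is the `k`-th letter from the end of the word `σ(u_{-k} ⋯ u_{-1})`. (As `σ` is
non-erasing, these words are long enough.) -/
def onBiinfinite {A : Type*} (σ : Substitution A) (u : ℤ → A) : ℤ → A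
  | .ofNat k => (σ.onWord (factor u 0 (k + 1)))[k]'(σ.lt_length_onWord_factor u 0 k)
  | .negSucc k =>
      (σ.onWord (factor u (-((k : ℤ) + 1)) (k + 1)))[
        (σ.onWord (factor u (-((k : ℤ) + 1)) (k + 1))).length - (k + 1)]'(by
          have h := σ.lt_length_onWord_factor u (-((k : ℤ) + 1)) k
          omega)

/-- The incidence matrix `M_σ`, with entry `|σ(a)|_b` at `(b, a)`. -/
def incidence {A : Type*} [DecidableEq A] (σ : Substitution A) : Matrix A A ℕ :=
  Matrix.of fun b a => (σ.image a).count b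

/-- The incidence matrix as an endomorphism of `ℝ^A`. -/
noncomputable def incidenceEnd {A : Type*} [Fintype A] [DecidableEq A] (σ : Substitution A) :
    Module.End ℝ (A → ℝ) :=
  Matrix.toLin' (σ.incidence.map (Nat.cast : ℕ → ℝ))

/-- `σ` is primitive: some power of its incidence matrix has only positive coefficients. -/
def IsPrimitive {A : Type*} [Fintype A] [DecidableEq A] (σ : Substitution A) : Prop :=
  (σ.incidence.map (Nat.cast : ℕ → ℝ)).IsPrimitive

/-- `β` is the Perron eigenvalue of the incidence matrix: a real eigenvalue that is equal to the
spectral radius. -/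
def IsPerronEigenvalue {A : Type*} [Fintype A] [DecidableEq A] (σ : Substitution A) (β : ℝ) :
    Prop :=
  σ.incidenceEnd.HasEigenvalue β ∧
    ∀ μ ∈ spectrum ℂ (σ.incidence.map (Nat.cast : ℕ → ℂ)), ‖μ‖ ≤ β

/-- The subshift `Ω_σ`: the smallest non-empty compact subset of `A^ℤ` (product topology, `A`
discrete) that is invariant by the shift map and by the substitution, that is, the intersection of
all such subsets. -/
def subshift {A : Type*} [TopologicalSpace A] (σ : Substitution A) : Set (ℤ → A) :=
  ⋂₀ {K | K.Nonempty ∧ IsCompact K ∧ shiftPow 1 '' K = K ∧ Set.MapsTo σ.onBiinfinite K K}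

end Substitution

/-- The abelianized `ab(w) = (|w|_a)_{a ∈ A}` of a finite word, as a vector of `ℝ^A`. -/
def ab {A : Type*} [DecidableEq A] (w : List A) : A → ℝ := fun a => (w.count a : ℝ)

/-- `ab(u_{[0,n)})` for `n ∈ ℤ`, with the convention `ab(u_{[0,n)}) = -ab(u_{[n,0)})` for
`n < 0`. -/
def abPrefix {A : Type*} [DecidableEq A] (u : ℤ → A) : ℤ → (A → ℝ)
  | .ofNat n => ab (factor u 0 n)
  | .negSucc n => -ab (factor u (-((n : ℤ) + 1)) (n + 1))

/-- The worm `W(u) = {ab(u_{[0,n)}) | n ∈ ℤ}` of a bi-infinite word. -/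
def worm {A : Type*} [DecidableEq A] (u : ℤ → A) : Set (A → ℝ) := Set.range (abPrefix u)

/-- `b --t--> a` is a transition of the abelianized prefix automaton: `σ(b) = p a s` for some
words `p`, `s` with `ab(p) = t`. -/
def Substitution.Transition {A : Type*} [DecidableEq A] (σ : Substitution A)
    (b : A) (t : A → ℝ) (a : A) : Prop :=
  ∃ p s : List A, σ.image b = p ++ a :: s ∧ t = ab p

/-- `β` is a Pisot number: a real algebraic integer `> 1` all of whose other conjugates have
modulus `< 1`. -/
def IsPisot (β : ℝ) : Prop :=
  IsIntegral ℤ β ∧ 1 < β ∧ ∀ γ ∈ (minpoly ℚ β).aroots ℂ, γ ≠ (β : ℂ) → ‖γ‖ < 1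

/-- `β` is an algebraic unit: an algebraic integer whose minimal polynomial has constant term
`±1`. -/
def IsAlgebraicUnit (β : ℝ) : Prop :=
  IsIntegral ℤ β ∧ ((minpoly ℚ β).coeff 0 = 1 ∨ (minpoly ℚ β).coeff 0 = -1)

/-- `V : ℝ^A → ℝ^d` is a projection along the subspace `F`: its kernel is `F` and
`d + dim F = |A|`. -/
def IsProjectionAlong {A : Type*} [Fintype A] {d : ℕ}
    (V : (A → ℝ) →ₗ[ℝ] EuclideanSpace ℝ (Fin d)) (F : Submodule ℝ (A → ℝ)) : Prop :=
  LinearMap.ker V = F ∧ d + Module.finrank ℝ F = Fintype.card A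

/-- The continuous extension to the orbit closure of `u` of the map `S^n u ↦ V ab(u_{[0,n)})`: its
value at `v` is the limit of `V ab(u_{[0,n)})` as `S^n u → v` (junk where there is no limit). -/
noncomputable def rauzyMap {A : Type*} [DecidableEq A] [TopologicalSpace A] {d : ℕ}
    (V : (A → ℝ) →ₗ[ℝ] EuclideanSpace ℝ (Fin d)) (u v : ℤ → A) : EuclideanSpace ℝ (Fin d) :=
  limUnder (comap (fun n : ℤ => shiftPow n u) (𝓝 v)) fun n : ℤ => V (abPrefix u n)

/-- The piece `R_a = φ([a])` of the Rauzy fractal `R = φ(Ω_σ)`, where `[a] = {v ∈ Ω_σ | v_0 = a}`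
and `φ` is the Rauzy map. -/
noncomputable def rauzyPiece {A : Type*} [DecidableEq A] [TopologicalSpace A] {d : ℕ}
    (σ : Substitution A) (V : (A → ℝ) →ₗ[ℝ] EuclideanSpace ℝ (Fin d)) (u : ℤ → A) (a : A) :
    Set (EuclideanSpace ℝ (Fin d)) :=
  rauzyMap V u '' {v ∈ σ.subshift | v 0 = a}

end RauzyFractal

/-! Let `y > 0` be the left Perron eigenvector of `M`. Everything rests on three facts about the
kernel `F` of `V`. Since `β` is a simple eigenvalue, `q = π_β / (X - β)` is coprime to `(X - β) P`,
hence is the characteristic polynomial of the map `N` induced on the quotient by `F`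
(`charpoly_quotient`). The Pisot hypothesis makes the powers of `N` contract, and the unit
hypothesis gives `|det N| = 1/β`. Next, `F ∩ ker y = ker P(M)` and `P(M)` preserves integer vectors,
so the integer vectors `x` with `y · x` bounded have a locally finite image by `V`
(`finite_image_strip`). Finally, `β` is irrational, so `F` contains no non-zero non-negative integer
vector (`eq_zero_of_mem_ker`); this gives injectivity on worms.

The values `V ab(u_{[0,n)})` are bounded because substituting acts as the contraction `N` up to a
bounded error. A bounded cocycle over a minimal system is a coboundary (Gottschalk–Hedlund): the
closure of the graph of `φ` on the orbit is still a graph (`eq_of_mem_graphClosure`). Desubstituting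
the points of the subshift then decomposes the pieces.

For the interior, translate each `R_a` by the `V x` with `x` integer and `0 ≤ y · x ≤ y_a`. The
union is closed, relatively dense and stable by `N` (`map_mem_covering`, the dual substitution), so
contraction makes it the whole space, and Baire gives some piece an interior. Primitivity carries it
to all the pieces, and small copies carry it close to every point.

For measures, the decomposition gives `β r ≤ M r`, where `r` is the vector of the measures of the
pieces. Pairing with `y` forces equality (`eq_of_le_of_left_eigenvector`), so the copies cannot
overlap. The measures of the boundaries satisfy the same inequality. If they were not zero they
would all be positive, but a small copy inside the interior adds nothing to the boundary, and
equality would fail. -/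

namespace RauzyFractal

/-! ### Perron–Frobenius theory of primitive matrices. -/

section Perron

open Matrix

variable {A : Type*} [Fintype A]

theorem mulVec_pos_of_pos {B : Matrix A A ℝ} (hB : ∀ i j, 0 < B i j) {w : A → ℝ}
    (hw : ∀ a, 0 ≤ w a) (hw0 : w ≠ 0) (a : A) : 0 < (B *ᵥ w) a := by
  obtain ⟨b, hb⟩ := Function.ne_iff.1 hw0
  have hb' : 0 < w b := lt_of_le_of_ne (hw b) (Ne.symm hb)
  exact Finset.sum_pos' (fun i _ => mul_nonneg (hB a i).le (hw i))
    ⟨b, Finset.mem_univ _, mul_pos (hB a b) hb'⟩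

/-- If `x` is an eigenvector of the nonnegative matrix `B`, then `β |x| ≤ B |x|`. -/
theorem abs_eigenvector_le {B : Matrix A A ℝ} (hB : ∀ i j, 0 ≤ B i j) {β : ℝ} (hβ : 0 ≤ β)
    {x : A → ℝ} (hx : B *ᵥ x = β • x) (a : A) : β * |x a| ≤ (B *ᵥ fun b => |x b|) a := by
  have h1 : (B *ᵥ x) a = β * x a := by rw [hx]; rfl
  rw [← abs_of_nonneg hβ, ← abs_mul, ← h1]
  refine (Finset.abs_sum_le_sum_abs _ _).trans (Finset.sum_le_sum fun b _ => ?_)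
  rw [abs_mul, abs_of_nonneg (hB a b)]

/-- If `y > 0` is a left eigenvector, then `β x ≤ B x` implies the equality. -/
theorem eq_of_le_of_left_eigenvector {B : Matrix A A ℝ} {β : ℝ} {y : A → ℝ}
    (hy : ∀ a, 0 < y a) (hyB : y ᵥ* B = β • y) {x : A → ℝ}
    (hx : ∀ a, β * x a ≤ (B *ᵥ x) a) : B *ᵥ x = β • x := by
  have h1 : y ⬝ᵥ (B *ᵥ x - β • x) = 0 := by
    rw [dotProduct_sub, dotProduct_mulVec, hyB, smul_dotProduct, dotProduct_smul, sub_self]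
  have h2 := (Finset.sum_eq_zero_iff_of_nonneg (fun a _ => mul_nonneg (hy a).le
    (by simpa using hx a : 0 ≤ (B *ᵥ x - β • x) a))).1 h1
  funext a
  have h3 := h2 a (Finset.mem_univ a)
  have h4 := (mul_eq_zero.1 h3).resolve_left (hy a).ne'
  simpa [sub_eq_zero] using h4

variable [DecidableEq A]

theorem pow_mulVec_eigenvector {B : Matrix A A ℝ} {s : ℝ} {y : A → ℝ} (h : B *ᵥ y = s • y)
    (k : ℕ) : (B ^ k) *ᵥ y = s ^ k • y := by
  induction k with
  | zero => simp
  | succ k ih => rw [pow_succ, ← mulVec_mulVec, h, mulVec_smul, ih, smul_smul, pow_succ, mul_comm]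

/-- A non-zero non-negative eigenvector of a primitive matrix is positive. -/
theorem pos_of_nonneg_eigenvector {B : Matrix A A ℝ} (hB : B.IsPrimitive) {s : ℝ} {y : A → ℝ}
    (h : B *ᵥ y = s • y) (hy : ∀ a, 0 ≤ y a) (hy0 : y ≠ 0) (a : A) : 0 < y a := by
  obtain ⟨k, -, hk⟩ := hB.exists_pos_pow
  have h1 := mulVec_pos_of_pos hk hy hy0 a
  rw [pow_mulVec_eigenvector h k] at h1
  refine lt_of_le_of_ne (hy a) fun h0 => ?_
  simp [← h0] at h1

/-- A primitive matrix has a positive eigenvector: maximize `s` such that `s y ≤ B y` for some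
vector `y` of the simplex. -/
theorem exists_pos_eigenvector [Nonempty A] {B : Matrix A A ℝ} (hB : B.IsPrimitive) :
    ∃ (s : ℝ) (y : A → ℝ), (∀ a, 0 < y a) ∧ B *ᵥ y = s • y := by
  set K : Set ((A → ℝ) × ℝ) :=
    {q | (∀ a, 0 ≤ q.1 a) ∧ ∑ a, q.1 a = 1 ∧ 0 ≤ q.2 ∧ ∀ a, q.2 * q.1 a ≤ (B *ᵥ q.1) a} with hK
  have hcont : ∀ a, Continuous fun q : (A → ℝ) × ℝ => (B *ᵥ q.1) a := fun a => by
    simp only [mulVec, dotProduct]; fun_prop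
  have hKc : IsClosed K := by
    simp only [hK, Set.ofPred_and, Set.ofPred_forall]
    refine (isClosed_iInter fun a => isClosed_le (by fun_prop) (by fun_prop)).inter
      ((isClosed_eq (by fun_prop) (by fun_prop)).inter
      ((isClosed_le (by fun_prop) (by fun_prop)).inter
      (isClosed_iInter fun a => isClosed_le (by fun_prop) (hcont a))))
  have hle1 : ∀ q ∈ K, ∀ a, q.1 a ≤ 1 := fun q hq a => by
    rw [← hq.2.1]; exact Finset.single_le_sum (fun i _ => hq.1 i) (Finset.mem_univ a)
  have hKcpt : IsCompact K := by
    refine IsCompact.of_isClosed_subset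
      (((isCompact_univ_pi fun _ : A => isCompact_Icc (a := (0 : ℝ)) (b := 1))).prod
        (isCompact_Icc (a := (0 : ℝ)) (b := ∑ a, ∑ b, B a b))) hKc ?_
    rintro q hq
    refine ⟨fun a _ => ⟨hq.1 a, hle1 q hq a⟩, hq.2.2.1, ?_⟩
    calc q.2 = ∑ a, q.2 * q.1 a := by rw [← Finset.mul_sum, hq.2.1, mul_one]
      _ ≤ ∑ a, (B *ᵥ q.1) a := Finset.sum_le_sum fun a _ => hq.2.2.2 a
      _ ≤ ∑ a, ∑ b, B a b := Finset.sum_le_sum fun a _ => Finset.sum_le_sum fun b _ =>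
          mul_le_of_le_one_right (hB.nonneg a b) (hle1 q hq b)
  have hcard : (0 : ℝ) < Fintype.card A := by exact_mod_cast Fintype.card_pos
  have hKne : K.Nonempty := by
    refine ⟨(fun _ => (Fintype.card A : ℝ)⁻¹, 0), fun a => by positivity, ?_, le_rfl, fun a => ?_⟩
    · simp [hcard.ne']
    · simp only [zero_mul]
      exact Finset.sum_nonneg fun b _ => mul_nonneg (hB.nonneg a b) (by positivity)
  obtain ⟨⟨y, s⟩, hq, hmax⟩ := hKcpt.exists_isMaxOn hKne continuous_snd.continuousOn
  obtain ⟨hy0, hy1, hs0, hys⟩ := hq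
  simp only at hy0 hy1 hs0 hys
  have hyne : y ≠ 0 := by rintro rfl; simp at hy1
  have heig : B *ᵥ y = s • y := by
    by_contra hne
    obtain ⟨k, -, hk⟩ := hB.exists_pos_pow
    -- If the defect `w` of a maximizer were non-zero, `B ^ k` would make it positive in every
    -- entry, and `(B ^ k) y`, rescaled to the simplex, would allow the larger value `s + ε`.
    set w := B *ᵥ y - s • y with hw
    have hw0 : ∀ a, 0 ≤ w a := fun a => by
      have := hys a
      simp only [hw, Pi.sub_apply, Pi.smul_apply, smul_eq_mul]; linarith
    have hwpos := mulVec_pos_of_pos hk hw0 (sub_ne_zero.2 hne)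
    have hzpos := mulVec_pos_of_pos hk hy0 hyne
    set z := (B ^ k) *ᵥ y with hz
    have hBz : (B ^ k) *ᵥ w = B *ᵥ z - s • z := by
      rw [hw, mulVec_sub, mulVec_smul, hz, mulVec_mulVec, mulVec_mulVec, ← pow_succ, ← pow_succ']
    obtain ⟨a0, -, ha0⟩ := Finset.exists_min_image Finset.univ ((B ^ k) *ᵥ w)
      Finset.univ_nonempty
    set c := ∑ a, z a
    have hc : 0 < c := Finset.sum_pos (fun a _ => hzpos a) Finset.univ_nonempty
    set ε := ((B ^ k) *ᵥ w) a0 / c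
    have hε : 0 < ε := div_pos (hwpos a0) hc
    have hmem : (c⁻¹ • z, s + ε) ∈ K := by
      refine ⟨fun a => mul_nonneg (inv_nonneg.2 hc.le) (hzpos a).le, ?_, by simp only; linarith,
        fun a => ?_⟩
      · simp only [Pi.smul_apply, smul_eq_mul, ← Finset.mul_sum]
        exact inv_mul_cancel₀ hc.ne'
      · have h1 : ε * z a ≤ ((B ^ k) *ᵥ w) a := by
          calc ε * z a ≤ ε * c := mul_le_mul_of_nonneg_left
                (Finset.single_le_sum (fun i _ => (hzpos i).le) (Finset.mem_univ a)) hε.le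
            _ = ((B ^ k) *ᵥ w) a0 := div_mul_cancel₀ _ hc.ne'
            _ ≤ _ := ha0 a (Finset.mem_univ a)
        rw [hBz, Pi.sub_apply, Pi.smul_apply, smul_eq_mul] at h1
        simp only [mulVec_smul, Pi.smul_apply, smul_eq_mul]
        have h2 : (s + ε) * z a ≤ (B *ᵥ z) a := by linarith
        calc (s + ε) * (c⁻¹ * z a) = c⁻¹ * ((s + ε) * z a) := by ring
          _ ≤ _ := mul_le_mul_of_nonneg_left h2 (inv_nonneg.2 hc.le)
    have := hmax hmem
    simp only [Set.mem_ofPred_eq] at this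
    linarith
  exact ⟨s, y, pos_of_nonneg_eigenvector hB heig hy0 hyne, heig⟩

theorem isPrimitive_transpose {B : Matrix A A ℝ} (hB : B.IsPrimitive) : Bᵀ.IsPrimitive :=
  ⟨fun i j => hB.nonneg j i, hB.exists_pos_pow.imp fun k hk =>
    ⟨hk.1, fun i j => by rw [← transpose_pow]; exact hk.2 j i⟩⟩

/-- The Perron eigenvalue is simple: an eigenvector orthogonal to the left eigenvector is zero. -/
theorem eigenvector_eq_zero {B : Matrix A A ℝ} (hB : B.IsPrimitive) {β : ℝ} (hβ : 0 ≤ β)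
    {y : A → ℝ} (hy : ∀ a, 0 < y a) (hyB : y ᵥ* B = β • y) {x : A → ℝ}
    (hx : B *ᵥ x = β • x) (hyx : y ⬝ᵥ x = 0) : x = 0 := by
  have habs := eq_of_le_of_left_eigenvector hy hyB (abs_eigenvector_le hB.nonneg hβ hx)
  by_contra hne
  -- Orthogonality to `y > 0` gives `x` entries of both signs. But `|x| + x` is a non-zero
  -- non-negative eigenvector, hence positive everywhere, although it vanishes where `x` is
  -- negative.
  have key : ∀ z : A → ℝ, B *ᵥ z = β • z → y ⬝ᵥ z = 0 → z ≠ 0 → ∃ a, 0 < z a := by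
    intro z _ hz h0
    by_contra! hcon
    refine h0 (funext fun a => ?_)
    have := (Finset.sum_eq_zero_iff_of_nonpos
      (fun a _ => mul_nonpos_of_nonneg_of_nonpos (hy a).le (hcon a))).1 hz a (Finset.mem_univ a)
    exact (mul_eq_zero.1 this).resolve_left (hy a).ne'
  obtain ⟨a, ha⟩ := key x hx hyx hne
  obtain ⟨b, hb⟩ := key (-x) (by rw [mulVec_neg, hx, smul_neg])
    (by rw [dotProduct_neg, hyx, neg_zero]) (neg_ne_zero.2 hne)
  have hpos : B *ᵥ ((fun b => |x b|) + x) = β • ((fun b => |x b|) + x) := by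
    rw [mulVec_add, habs, hx, smul_add]
  have := pos_of_nonneg_eigenvector hB hpos (fun c => by
      have := neg_abs_le (x c); simp only [Pi.add_apply]; linarith)
    (Function.ne_iff.2 ⟨a, by simp only [Pi.add_apply, Pi.zero_apply]; positivity⟩) b
  simp only [Pi.add_apply, Pi.neg_apply] at this hb
  rw [abs_of_neg (by linarith)] at this
  linarith

/-- The left Perron eigenvector of a primitive matrix. -/
theorem exists_left_eigenvector {B : Matrix A A ℝ} (hB : B.IsPrimitive) {β : ℝ} (hβ : 0 ≤ β)
    {w : A → ℝ} (hw : B *ᵥ w = β • w) (hw0 : w ≠ 0)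
    (hmax : ∀ s : ℝ, ∀ y : A → ℝ, y ≠ 0 → y ᵥ* B = s • y → s ≤ β) :
    ∃ y : A → ℝ, (∀ a, 0 < y a) ∧ y ᵥ* B = β • y := by
  obtain ⟨a, ha⟩ := Function.ne_iff.1 hw0
  have : Nonempty A := ⟨a⟩
  obtain ⟨s, y, hy, hys⟩ := exists_pos_eigenvector (isPrimitive_transpose hB)
  rw [mulVec_transpose] at hys
  have hsβ : s ≤ β := hmax s y (fun h => by simpa [h] using hy a) hys
  -- Pairing `β |w| ≤ B |w|` with the left eigenvector compares the two eigenvalues.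
  have hβs : β ≤ s := by
    have h1 : β * (y ⬝ᵥ fun b => |w b|) ≤ s * (y ⬝ᵥ fun b => |w b|) := by
      rw [← smul_eq_mul, ← smul_eq_mul, ← smul_dotProduct, ← smul_dotProduct, ← hys,
        ← dotProduct_mulVec, smul_dotProduct, smul_eq_mul, dotProduct, Finset.mul_sum]
      refine Finset.sum_le_sum fun b _ => ?_
      have := mul_le_mul_of_nonneg_left (abs_eigenvector_le hB.nonneg hβ hw b) (hy b).le
      linarith
    refine le_of_mul_le_mul_right h1 (Finset.sum_pos' (fun b _ => mul_nonneg (hy b).le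
      (abs_nonneg _)) ⟨a, Finset.mem_univ _, mul_pos (hy a) (abs_pos.2 ha)⟩)
  exact ⟨y, hy, le_antisymm hsβ hβs ▸ hys⟩

/-- The Perron eigenvalue has algebraic multiplicity at most one. -/
theorem rootMultiplicity_charpoly_le_one {B : Matrix A A ℝ} (hB : B.IsPrimitive) {β : ℝ}
    (hβ : 0 ≤ β) {y : A → ℝ} (hy : ∀ a, 0 < y a) (hyB : y ᵥ* B = β • y) :
    B.charpoly.rootMultiplicity β ≤ 1 := by
  set f : Module.End ℝ (A → ℝ) := toLin' B
  have hf : f.charpoly = B.charpoly := by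
    rw [← LinearMap.charpoly_toMatrix f (Pi.basisFun ℝ A), LinearMap.toMatrix_eq_toMatrix',
      LinearMap.toMatrix'_toLin']
  rw [← hf, ← LinearMap.finrank_maxGenEigenspace_eq]
  -- The vector `(f - β) x` is always orthogonal to `y`, so the induction reduces to a genuine
  -- eigenvector orthogonal to `y`. Hence pairing with `y` is injective on the generalized
  -- eigenspace.
  have key : ∀ (n : ℕ) (x : A → ℝ), ((f - β • 1) ^ n) x = 0 → y ⬝ᵥ x = 0 → x = 0 := by
    intro n
    induction n with
    | zero => intro x hx _; simpa using hx
    | succ n ih =>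
      intro x hx hyx
      rw [pow_succ, Module.End.mul_apply] at hx
      have hx' : (f - β • 1) x = B *ᵥ x - β • x := rfl
      have h1 := ih _ hx (by
        rw [hx', dotProduct_sub, dotProduct_mulVec, hyB, smul_dotProduct, dotProduct_smul,
          sub_self])
      rw [hx', sub_eq_zero] at h1
      exact eigenvector_eq_zero hB hβ hy hyB h1 hyx
  let L : f.maxGenEigenspace β →ₗ[ℝ] ℝ :=
    (dotProductBilin ℝ ℝ y) ∘ₗ (f.maxGenEigenspace β).subtype
  have hL : Function.Injective L := by
    rw [← LinearMap.ker_eq_bot, LinearMap.ker_eq_bot']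
    rintro ⟨x, hx⟩ h
    obtain ⟨n, hn⟩ := (Module.End.mem_maxGenEigenspace f β x).1 hx
    exact Subtype.ext (key n x hn h)
  simpa using LinearMap.finrank_le_finrank_of_injective hL

end Perron

/-! ### Contracting powers, and the characteristic polynomial of a quotient. -/

section Charpoly

open Matrix

/-- In a complex Banach algebra, the powers of an element all of whose spectral values have modulus
`< 1` tend to zero. -/
theorem tendsto_pow_of_spectrum {R : Type*} [NormedRing R] [NormedAlgebra ℂ R] [CompleteSpace R]
    (a : R) (ha : ∀ z ∈ spectrum ℂ a, ‖z‖ < 1) : Tendsto (fun k : ℕ => a ^ k) atTop (𝓝 0) := by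
  rcases subsingleton_or_nontrivial R with h | h
  · exact tendsto_const_nhds.congr fun k => Subsingleton.elim 0 _
  have h1 : spectralRadius ℂ a < (1 : NNReal) :=
    spectrum.spectralRadius_lt_of_forall_lt a fun z hz => by exact_mod_cast ha z hz
  obtain ⟨r, hr1, hr2⟩ := ENNReal.lt_iff_exists_nnreal_btwn.1 h1
  -- Gelfand's formula: the `k`-th roots of the norms are eventually below `r < 1`.
  have h2 := (spectrum.pow_nnnorm_pow_one_div_tendsto_nhds_spectralRadius a).eventually
    (gt_mem_nhds hr1)
  have hr3 : (r : ℝ) < 1 := by exact_mod_cast hr2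
  refine squeeze_zero_norm' ?_ (tendsto_pow_atTop_nhds_zero_of_lt_one r.coe_nonneg hr3)
  filter_upwards [h2, eventually_gt_atTop 0] with k hk hk0
  have hk' : (0 : ℝ) < k := by exact_mod_cast hk0
  have := ENNReal.rpow_lt_rpow hk hk'
  rw [← ENNReal.rpow_mul, one_div, inv_mul_cancel₀ hk'.ne', ENNReal.rpow_one,
    ENNReal.rpow_natCast] at this
  exact_mod_cast this.le

variable {n : Type*} [Fintype n] [DecidableEq n]

attribute [local instance] Matrix.linftyOpNormedRing Matrix.linftyOpNormedAlgebra in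
theorem tendsto_matrix_pow (B : Matrix n n ℝ)
    (hB : ∀ z : ℂ, (B.map Complex.ofRealHom).charpoly.IsRoot z → ‖z‖ < 1) :
    Tendsto (fun k : ℕ => B ^ k) atTop (𝓝 0) := by
  have h1 : Tendsto (fun k : ℕ => (B.map Complex.ofRealHom) ^ k) atTop (𝓝 0) :=
    tendsto_pow_of_spectrum _ fun z hz => hB z (mem_spectrum_iff_isRoot_charpoly.1 hz)
  have h2 : ∀ k : ℕ, B ^ k = ((B.map Complex.ofRealHom) ^ k).map Complex.re := fun k => by
    rw [← Matrix.map_pow]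
    ext i j
    simp
  simp only [h2]
  have h3 : Continuous fun C : Matrix n n ℂ => C.map Complex.re :=
    continuous_id.matrix_map Complex.continuous_re
  simpa [Function.comp_def] using (h3.tendsto 0).comp h1

/-- A linear map whose eigenvalues have modulus `< 1` has contracting powers. -/
theorem exists_pow_contracting {E : Type*} [NormedAddCommGroup E] [NormedSpace ℝ E]
    [FiniteDimensional ℝ E] (N : Module.End ℝ E)
    (hN : ∀ z : ℂ, (N.charpoly.map Complex.ofRealHom).IsRoot z → ‖z‖ < 1) {ε : ℝ} (hε : 0 < ε) :
    ∃ k : ℕ, ∀ x : E, ‖(N ^ k) x‖ ≤ ε * ‖x‖ := by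
  let b := Module.finBasis ℝ E
  let B := LinearMap.toMatrix b b N
  have h1 : Tendsto (fun k : ℕ => B ^ k) atTop (𝓝 0) := tendsto_matrix_pow B fun z hz => by
    refine hN z ?_
    rwa [← LinearMap.charpoly_toMatrix N b, ← Matrix.charpoly_map]
  let T : Matrix (Fin (Module.finrank ℝ E)) (Fin (Module.finrank ℝ E)) ℝ →ₗ[ℝ] (E →L[ℝ] E) :=
    (LinearMap.toContinuousLinearMap : (E →ₗ[ℝ] E) ≃ₗ[ℝ] E →L[ℝ] E).toLinearMap ∘ₗ
      (Matrix.toLin b b).toLinearMap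
  have h2 : Tendsto (fun k : ℕ => ‖T (B ^ k)‖) atTop (𝓝 0) := by
    have hc : Continuous T := T.continuous_of_finiteDimensional
    have := ((hc.norm).tendsto 0).comp h1
    simpa [Function.comp_def] using this
  obtain ⟨k, hk⟩ := (h2.eventually (gt_mem_nhds hε)).exists
  refine ⟨k, fun x => ?_⟩
  have h3 : (N ^ k) x = T (B ^ k) x := by
    have : Matrix.toLin b b (B ^ k) = N ^ k := by
      rw [LinearMap.toMatrix_pow b N k, Matrix.toLin_toMatrix]
    change (N ^ k) x = (Matrix.toLin b b (B ^ k)) x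
    rw [this]
  rw [h3]
  exact ((T (B ^ k)).le_opNorm x).trans (mul_le_mul_of_nonneg_right hk.le (norm_nonneg _))

/-- A divisor of the characteristic polynomial that is coprime to an annihilating polynomial is
constant. -/
theorem natDegree_eq_zero_of_dvd_charpoly (B : Matrix n n ℝ) {h K : ℝ[X]} (hh : h ∣ B.charpoly)
    (hK : aeval B K = 0) (hcop : IsCoprime h K) : h.natDegree = 0 := by
  by_contra hdeg
  set i : ℝ →+* ℂ := Complex.ofRealHom
  -- A complex root `γ` of `h` is an eigenvalue of `B`, hence a root of the minimal polynomial and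
  -- of `K`, against coprimality.
  obtain ⟨γ, hγ⟩ := IsAlgClosed.exists_root (h.map i) (by
    rw [degree_map]; exact fun h0 => hdeg (natDegree_eq_of_degree_eq_some h0))
  have h1 : (B.map i).charpoly.IsRoot γ := by
    rw [Matrix.charpoly_map]
    exact hγ.dvd (Polynomial.map_dvd i hh)
  rw [← Matrix.charpoly_toLin', ← Module.End.hasEigenvalue_iff_isRoot_charpoly,
    Module.End.hasEigenvalue_iff_isRoot, Matrix.minpoly_toLin'] at h1
  have h2 : aeval (B.map i) (K.map i) = 0 := by
    have : aeval (B.map i) (K.map i) = (aeval B K).map i := by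
      have h3 := Polynomial.map_aeval_eq_aeval_map (φ := i) (ψ := i.mapMatrix (m := n))
        (by ext r a b : 2
            simp [Matrix.algebraMap_eq_diagonal, Matrix.diagonal_apply]
            split_ifs <;> simp) K B
      simpa using h3.symm
    rw [this, hK]
    ext; simp
  have h4 : (K.map i).IsRoot γ := h1.dvd (minpoly.dvd ℂ _ h2)
  obtain ⟨a, b, hab⟩ := hcop.map (mapRingHom i)
  have := congrArg (eval γ) hab
  simp only [coe_mapRingHom, eval_add, eval_mul, eval_one] at this
  rw [IsRoot.def.1 hγ, IsRoot.def.1 h4] at this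
  simp at this

/-- The quotient map by the kernel of `K(M)`, where the characteristic polynomial is `K q`, has
characteristic polynomial `q` when `q` is separable, coprime to `K` and of the right degree. -/
theorem charpoly_quotient {E : Type*} [AddCommGroup E] [Module ℝ E] [FiniteDimensional ℝ E]
    (B : Matrix n n ℝ) {K q : ℝ[X]} (hBc : B.charpoly = K * q) (hq : q.Monic)
    (hsep : q.Separable) (hcop : IsCoprime q K) (hdeg : q.natDegree = Module.finrank ℝ E)
    {V : (n → ℝ) →ₗ[ℝ] E} (hV : Function.Surjective V)
    (hker : LinearMap.ker V = LinearMap.ker (aeval (toLin' B) K)) {N : Module.End ℝ E}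
    (hN : N ∘ₗ V = V ∘ₗ toLin' B) : N.charpoly = q := by
  have hNp : ∀ r : ℝ[X], (aeval N r) ∘ₗ V = V ∘ₗ aeval (toLin' B) r := by
    intro r
    induction r using Polynomial.induction_on' with
    | add r s hr hs => rw [map_add, map_add, LinearMap.add_comp, LinearMap.comp_add, hr, hs]
    | monomial k c =>
      have hk : ∀ k : ℕ, (N ^ k) ∘ₗ V = V ∘ₗ (toLin' B) ^ k := by
        intro k
        induction k with
        | zero => rfl
        | succ k ih =>
          rw [pow_succ, pow_succ', Module.End.mul_eq_comp, Module.End.mul_eq_comp,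
            LinearMap.comp_assoc, hN, ← LinearMap.comp_assoc, ih, LinearMap.comp_assoc,
            ← Module.End.mul_eq_comp, ← Module.End.mul_eq_comp, ← pow_succ, ← pow_succ']
      ext x
      have := LinearMap.congr_fun (hk k) (Pi.single x 1)
      simp only [LinearMap.comp_apply] at this
      simp [aeval_monomial, Algebra.algebraMap_eq_smul_one, this]
  -- If `r(N) = 0` then `r(B)` takes its values in `ker V = ker K(B)`.
  have hzero : ∀ r : ℝ[X], aeval N r = 0 → aeval B (K * r) = 0 := by
    intro r hr
    have h1 : aeval (toLin' B) (K * r) = 0 := by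
      refine LinearMap.ext fun x => ?_
      have h2 : aeval (toLin' B) r x ∈ LinearMap.ker V := by
        have := LinearMap.congr_fun (hNp r) x
        rw [hr] at this
        exact this.symm
      rw [hker] at h2
      rw [map_mul]
      exact h2
    have h3 : aeval (toLinAlgEquiv' B) (K * r) = 0 := h1
    rw [Polynomial.aeval_algEquiv] at h3
    exact (map_eq_zero_iff _ toLinAlgEquiv'.injective).1 h3
  have hq0 : aeval N q = 0 := by
    refine LinearMap.ext fun e => ?_
    obtain ⟨x, rfl⟩ := hV e
    rw [← LinearMap.comp_apply, hNp, LinearMap.comp_apply]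
    have : aeval (toLin' B) q x ∈ LinearMap.ker V := by
      rw [hker, LinearMap.mem_ker, ← Module.End.mul_apply, ← map_mul, ← hBc,
        ← Matrix.charpoly_toLin', LinearMap.aeval_self_charpoly]
      rfl
    exact this
  -- The cofactor `h` of the minimal polynomial in `q` divides the characteristic polynomial of `B`
  -- and is coprime to `K * minpoly ℝ N`, which annihilates `B`; so it is constant, and `q` is the
  -- minimal polynomial. The degree does the rest.
  obtain ⟨h, hh⟩ := minpoly.dvd ℝ N hq0
  have hgm : (minpoly ℝ N).Monic := minpoly.monic (Algebra.IsIntegral.isIntegral N)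
  have hhm : h.Monic := hgm.of_mul_monic_left (hh ▸ hq)
  have hh0 : h.natDegree = 0 := by
    refine natDegree_eq_zero_of_dvd_charpoly B (K := K * minpoly ℝ N) ?_
      (hzero _ (minpoly.aeval ℝ N)) ?_
    · rw [hBc, hh]; exact ⟨K * minpoly ℝ N, by ring⟩
    · refine IsCoprime.mul_right (hcop.of_isCoprime_of_dvd_left ⟨minpoly ℝ N, by rw [hh]; ring⟩) ?_
      rw [hh] at hsep
      exact hsep.isCoprime.symm
  have hh1 : h = 1 := hhm.natDegree_eq_zero.1 hh0
  rw [hh1, mul_one] at hh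
  rw [hh]
  refine (eq_of_monic_of_dvd_of_natDegree_le hgm (LinearMap.charpoly_monic N)
    (LinearMap.minpoly_dvd_charpoly N) ?_)
  rw [LinearMap.charpoly_natDegree, ← hdeg, hh]

end Charpoly

/-! ### Arithmetic of the Pisot unit and the map induced on the quotient. -/

theorem not_mem_range_of_pisot_unit {β : ℝ} (hPisot : IsPisot β) (hunit : IsAlgebraicUnit β)
    (r : ℚ) : (r : ℝ) ≠ β := by
  intro h
  -- A rational `β` would have a linear minimal polynomial with constant term `-r`; being a unit, it
  -- would be `±1`, against `1 < β`.
  have h1 : minpoly ℚ β = X - C r := by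
    rw [← h]; exact minpoly.eq_X_sub_C ℝ r
  have h2 := hunit.2
  have h3 := hPisot.2.1
  rw [h1] at h2
  simp only [coeff_sub, coeff_X_zero, coeff_C_zero, zero_sub] at h2
  rcases h2 with h2 | h2
  · have : r = -1 := by linarith
    rw [← h, this] at h3; norm_num at h3
  · have : r = 1 := by linarith
    rw [← h, this] at h3; norm_num at h3

theorem surjective_of_isProjectionAlong {A : Type*} [Fintype A] {d : ℕ}
    {V : (A → ℝ) →ₗ[ℝ] EuclideanSpace ℝ (Fin d)} {F : Submodule ℝ (A → ℝ)}
    (hV : IsProjectionAlong V F) : Function.Surjective V := by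
  rw [← LinearMap.range_eq_top]
  refine Submodule.eq_top_of_finrank_eq ?_
  have h1 := V.finrank_range_add_finrank_ker
  have h2 := hV.2
  rw [hV.1] at h1
  simp only [Module.finrank_fintype_fun_eq_card, finrank_euclideanSpace, Fintype.card_fin] at *
  omega

section

open Matrix

variable {A : Type*} [Fintype A] [DecidableEq A]

/-- The incidence matrix with real coefficients. -/
def Substitution.realMatrix (σ : Substitution A) : Matrix A A ℝ :=
  σ.incidence.map (Nat.cast : ℕ → ℝ)

variable {σ : Substitution A} {β : ℝ}

theorem Substitution.exists_left_eigenvector (hσ : σ.IsPrimitive) (hβ : σ.IsPerronEigenvalue β)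
    (hβ0 : 0 ≤ β) : ∃ y : A → ℝ, (∀ a, 0 < y a) ∧ y ᵥ* σ.realMatrix = β • y := by
  obtain ⟨w, hw⟩ := hβ.1.exists_hasEigenvector
  refine RauzyFractal.exists_left_eigenvector hσ hβ0 hw.apply_eq_smul hw.2 fun s y hy hys => ?_
  have h1 : Module.End.HasEigenvalue (toLin' σ.realMatrixᵀ) s := by
    refine Module.End.hasEigenvalue_of_hasEigenvector (x := y) ⟨?_, hy⟩
    rw [Module.End.mem_eigenspace_iff, toLin'_apply, mulVec_transpose]
    exact hys
  rw [Module.End.hasEigenvalue_iff_isRoot_charpoly, Matrix.charpoly_toLin',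
    Matrix.charpoly_transpose] at h1
  have h2 : (s : ℂ) ∈ spectrum ℂ (σ.incidence.map (Nat.cast : ℕ → ℂ)) := by
    rw [mem_spectrum_iff_isRoot_charpoly]
    have : σ.incidence.map (Nat.cast : ℕ → ℂ) = σ.realMatrix.map Complex.ofRealHom := by
      ext; simp [Substitution.realMatrix]
    rw [this, Matrix.charpoly_map]
    exact h1.map (f := Complex.ofRealHom)
  have := hβ.2 _ h2
  rw [Complex.norm_real, Real.norm_eq_abs] at this
  exact (le_abs_self s).trans this

theorem Substitution.charpoly_realMatrix {P : ℤ[X]}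
    (hP : (σ.incidence.map (Nat.cast : ℕ → ℚ)).charpoly =
      minpoly ℚ β * P.map (Int.castRingHom ℚ)) :
    σ.realMatrix.charpoly =
      (minpoly ℚ β).map (algebraMap ℚ ℝ) * P.map (Int.castRingHom ℝ) := by
  have : σ.realMatrix = (σ.incidence.map (Nat.cast : ℕ → ℚ)).map (algebraMap ℚ ℝ) := by
    ext; simp [Substitution.realMatrix]
  rw [this, Matrix.charpoly_map, hP, Polynomial.map_mul, Polynomial.map_map]
  congr 2

/-- If `P(β)` were zero, `β` would be a double root of the characteristic polynomial, against the
simplicity of the Perron eigenvalue. -/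
theorem Substitution.aeval_ne_zero (hσ : σ.IsPrimitive) (hβ0 : 0 ≤ β) {P : ℤ[X]}
    (hP : (σ.incidence.map (Nat.cast : ℕ → ℚ)).charpoly =
      minpoly ℚ β * P.map (Int.castRingHom ℚ))
    {y : A → ℝ} (hy : ∀ a, 0 < y a) (hyM : y ᵥ* σ.realMatrix = β • y) :
    (P.map (Int.castRingHom ℝ)).eval β ≠ 0 := by
  intro h0
  have h1 : ((minpoly ℚ β).map (algebraMap ℚ ℝ)).IsRoot β := by
    rw [IsRoot.def, eval_map_algebraMap, minpoly.aeval]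
  have h2 : (X - C β) ^ 2 ∣ σ.realMatrix.charpoly := by
    rw [Substitution.charpoly_realMatrix hP, pow_two]
    exact mul_dvd_mul (dvd_iff_isRoot.2 h1) (dvd_iff_isRoot.2 h0)
  have h3 := (le_rootMultiplicity_iff (Matrix.charpoly_monic _).ne_zero).2 h2
  have h4 : σ.realMatrix.charpoly.rootMultiplicity β ≤ 1 :=
    rootMultiplicity_charpoly_le_one hσ hβ0 hy hyM
  omega

/-- The factorization `π_β = (X - β) q` over the reals. -/
theorem exists_conjugate_factor (hβ : IsIntegral ℤ β) : ∃ q : ℝ[X],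
    (minpoly ℚ β).map (algebraMap ℚ ℝ) = (X - C β) * q ∧ q.Monic ∧ q.Separable ∧
    IsCoprime q (X - C β) ∧ (minpoly ℚ β).natDegree = q.natDegree + 1 := by
  have hint : IsIntegral ℚ β := hβ.tower_top
  have h1 : ((minpoly ℚ β).map (algebraMap ℚ ℝ)).IsRoot β := by
    rw [IsRoot.def, eval_map_algebraMap, minpoly.aeval]
  obtain ⟨q, hq⟩ := dvd_iff_isRoot.2 h1
  have hm : ((minpoly ℚ β).map (algebraMap ℚ ℝ)).Monic := (minpoly.monic hint).map _
  have hqm : q.Monic := (monic_X_sub_C β).of_mul_monic_left (hq ▸ hm)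
  have hsep : ((X - C β) * q).Separable := by
    rw [← hq]; exact ((minpoly.irreducible hint).separable).map
  refine ⟨q, hq, hqm, hsep.of_mul_right, hsep.isCoprime.symm, ?_⟩
  rw [← natDegree_map (algebraMap ℚ ℝ), hq, (monic_X_sub_C β).natDegree_mul hqm, natDegree_X_sub_C,
    add_comm]

/-- The polynomial whose value at the incidence matrix has kernel `F`. -/
noncomputable def kerPolynomial (β : ℝ) (P : ℤ[X]) : ℝ[X] :=
  (X - C β) * P.map (Int.castRingHom ℝ)

theorem aeval_kerPolynomial (P : ℤ[X]) :
    aeval σ.incidenceEnd (kerPolynomial β P) =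
      (σ.incidenceEnd - β • 1) * aeval σ.incidenceEnd P := by
  rw [kerPolynomial, map_mul, map_sub, aeval_X, aeval_C, Algebra.algebraMap_eq_smul_one]
  congr 1
  exact aeval_map_algebraMap ℝ σ.incidenceEnd P

theorem exists_factor_of_ker_le {W E G : Type*} [AddCommGroup W] [Module ℝ W] [AddCommGroup E]
    [Module ℝ E] [AddCommGroup G] [Module ℝ G] {f : W →ₗ[ℝ] E} {g : W →ₗ[ℝ] G}
    (h : LinearMap.ker f ≤ LinearMap.ker g) : ∃ D : E →ₗ[ℝ] G, ∀ x, D (f x) = g x := by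
  obtain ⟨D, hD⟩ := LinearMap.exists_extend
    (((LinearMap.ker f).liftQ g h) ∘ₗ f.quotKerEquivRange.symm.toLinearMap)
  refine ⟨D, fun x => ?_⟩
  have h1 := LinearMap.congr_fun hD ⟨f x, LinearMap.mem_range_self f x⟩
  have h2 : f.quotKerEquivRange.symm ⟨f x, LinearMap.mem_range_self f x⟩ =
      (LinearMap.ker f).mkQ x := by
    rw [LinearEquiv.symm_apply_eq]; rfl
  simp only [LinearMap.comp_apply, LinearEquiv.coe_coe, Submodule.subtype_apply, h2,
    Submodule.mkQ_apply, Submodule.liftQ_apply] at h1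
  exact h1

theorem exists_quotient_map {W E : Type*} [AddCommGroup W] [Module ℝ W] [AddCommGroup E]
    [Module ℝ E] {V : W →ₗ[ℝ] E} (hV : Function.Surjective V) (f : Module.End ℝ W)
    (h : ∀ x, V x = 0 → V (f x) = 0) : ∃ N : Module.End ℝ E, N ∘ₗ V = V ∘ₗ f := by
  obtain ⟨g, hg⟩ := V.exists_rightInverse_of_surjective (LinearMap.range_eq_top.2 hV)
  refine ⟨V ∘ₗ f ∘ₗ g, LinearMap.ext fun x => ?_⟩
  have h1 : V (g (V x) - x) = 0 := by
    rw [map_sub, ← LinearMap.comp_apply, hg, LinearMap.id_apply, sub_self]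
  have h2 := h _ h1
  rw [map_sub, map_sub, sub_eq_zero] at h2
  exact h2

/-- Constant terms in `π_β = (X - β) q` give `π_β(0) = -β q(0)`, of modulus `1` for a unit, and
`|q(0)|` is `|det N|`. -/
theorem det_eq_of_charpoly {E : Type*} [AddCommGroup E] [Module ℝ E] [FiniteDimensional ℝ E]
    (N : Module.End ℝ E) {q : ℝ[X]} (hN : N.charpoly = q)
    (hq : (minpoly ℚ β).map (algebraMap ℚ ℝ) = (X - C β) * q) (hunit : IsAlgebraicUnit β)
    (hβ : 0 < β) : |LinearMap.det N| = 1 / β := by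
  have h1 : |q.coeff 0| * β = 1 := by
    have h2 := congrArg (fun p : ℝ[X] => p.coeff 0) hq
    simp only [coeff_map, mul_coeff_zero, coeff_sub, coeff_X_zero, coeff_C_zero, zero_sub] at h2
    have h3 : |((minpoly ℚ β).coeff 0 : ℝ)| = 1 := by
      rcases hunit.2 with h | h <;> rw [h] <;> norm_num
    rw [eq_ratCast] at h2
    rw [h2, abs_mul, abs_neg, abs_of_pos hβ] at h3
    linarith
  rw [LinearMap.det_eq_sign_charpoly_coeff, hN, abs_mul, abs_pow, abs_neg, abs_one, one_pow,
    one_mul, eq_div_iff hβ.ne', h1]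

/-- Over `ℚ`, the irreducible `π_β` does not divide `P`, so they are coprime; this persists over `ℝ`
and for the factor `q` of `π_β`. -/
theorem isCoprime_conjugate_factor (hβ : IsIntegral ℤ β) {P : ℤ[X]}
    (hPβ : (P.map (Int.castRingHom ℝ)).eval β ≠ 0) {q : ℝ[X]}
    (hq : (minpoly ℚ β).map (algebraMap ℚ ℝ) = (X - C β) * q) (hqβ : IsCoprime q (X - C β)) :
    IsCoprime q (kerPolynomial β P) := by
  have hint : IsIntegral ℚ β := hβ.tower_top
  have hmap : (P.map (Int.castRingHom ℚ)).map (algebraMap ℚ ℝ) = P.map (Int.castRingHom ℝ) := by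
    rw [Polynomial.map_map]; congr 1
  refine hqβ.mul_right ?_
  have h1 : IsCoprime (minpoly ℚ β) (P.map (Int.castRingHom ℚ)) := by
    rw [(minpoly.irreducible hint).coprime_iff_not_dvd]
    intro hdvd
    apply hPβ
    rw [← hmap, eval_map_algebraMap]
    exact (minpoly.dvd_iff).1 hdvd
  have h2 := h1.map (mapRingHom (algebraMap ℚ ℝ))
  simp only [coe_mapRingHom] at h2
  rw [hq, hmap] at h2
  exact h2.of_mul_left_right

/-! ### Integer vectors and the kernel of `V`. -/

section Arithmetic

variable {y : A → ℝ}

theorem dotProduct_aeval (hyM : y ᵥ* σ.realMatrix = β • y) (p : ℝ[X]) (x : A → ℝ) :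
    y ⬝ᵥ (aeval σ.incidenceEnd p x) = p.eval β * (y ⬝ᵥ x) := by
  have h1 : ∀ x, y ⬝ᵥ (σ.incidenceEnd x) = β * (y ⬝ᵥ x) := fun x => by
    rw [← smul_eq_mul, ← smul_dotProduct, ← hyM, ← dotProduct_mulVec]
    rfl
  have h2 : ∀ (k : ℕ) (x : A → ℝ), y ⬝ᵥ ((σ.incidenceEnd ^ k) x) = β ^ k * (y ⬝ᵥ x) := by
    intro k
    induction k with
    | zero => simp
    | succ k ih => intro x; rw [pow_succ, Module.End.mul_apply, ih, h1]; ring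
  induction p using Polynomial.induction_on' with
  | add r s hr hs =>
    rw [map_add, LinearMap.add_apply, dotProduct_add, hr, hs, eval_add, add_mul]
  | monomial k c =>
    rw [aeval_monomial, Module.End.mul_apply, Algebra.algebraMap_eq_smul_one, LinearMap.smul_apply,
      Module.End.one_apply, dotProduct_smul, h2, eval_monomial, smul_eq_mul, mul_assoc]

/-- `F ∩ ker y = ker P(M)`: the non trivial inclusion. -/
theorem aeval_eq_zero_of_mem (hσ : σ.IsPrimitive) (hβ0 : 0 ≤ β) (hy : ∀ a, 0 < y a)
    (hyM : y ᵥ* σ.realMatrix = β • y) {P : ℤ[X]} {x : A → ℝ}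
    (hx : aeval σ.incidenceEnd (kerPolynomial β P) x = 0) (hyx : y ⬝ᵥ x = 0) :
    aeval σ.incidenceEnd (P.map (Int.castRingHom ℝ)) x = 0 := by
  refine eigenvector_eq_zero (B := σ.realMatrix) hσ hβ0 hy hyM ?_ ?_
  · rw [kerPolynomial, map_mul, map_sub, aeval_X, aeval_C, Algebra.algebraMap_eq_smul_one,
      Module.End.mul_apply, LinearMap.sub_apply, LinearMap.smul_apply, Module.End.one_apply,
      sub_eq_zero] at hx
    exact hx
  · rw [dotProduct_aeval hyM, hyx, mul_zero]

/-- An integer polynomial of the incidence matrix maps integer vectors to integer vectors. -/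
theorem exists_int_aeval (P : ℤ[X]) (x : A → ℤ) : ∃ z : A → ℤ,
    aeval σ.incidenceEnd (P.map (Int.castRingHom ℝ)) (fun a => (x a : ℝ)) =
      fun a => (z a : ℝ) := by
  have h1 : ∀ (k : ℕ) (x : A → ℤ), ∃ z : A → ℤ,
      (σ.incidenceEnd ^ k) (fun a => (x a : ℝ)) = fun a => (z a : ℝ) := by
    intro k
    induction k with
    | zero => exact fun x => ⟨x, rfl⟩
    | succ k ih =>
      intro x
      obtain ⟨z, hz⟩ := ih fun a => ∑ b, (σ.incidence a b : ℤ) * x b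
      refine ⟨z, ?_⟩
      rw [pow_succ, Module.End.mul_apply, ← hz]
      congr 1
      funext a
      simp [Substitution.incidenceEnd, mulVec, dotProduct]
  induction P using Polynomial.induction_on' with
  | add r s hr hs =>
    obtain ⟨z, hz⟩ := hr
    obtain ⟨w, hw⟩ := hs
    refine ⟨z + w, ?_⟩
    rw [Polynomial.map_add, map_add, LinearMap.add_apply, hz, hw]
    funext a
    simp
  | monomial k c =>
    obtain ⟨z, hz⟩ := h1 k x
    refine ⟨c • z, ?_⟩
    rw [map_monomial, aeval_monomial, Module.End.mul_apply, hz]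
    funext a
    simp

/-- `F` does not contain any non-zero non-negative integer vector. -/
theorem eq_zero_of_mem_ker (hβQ : ∀ r : ℚ, (r : ℝ) ≠ β) (hy : ∀ a, 0 < y a)
    (hyM : y ᵥ* σ.realMatrix = β • y) {P : ℤ[X]}
    (hPβ : (P.map (Int.castRingHom ℝ)).eval β ≠ 0) (w : A → ℕ)
    (hw : aeval σ.incidenceEnd (kerPolynomial β P) (fun a => (w a : ℝ)) = 0) (a : A) : w a = 0 := by
  obtain ⟨z, hz⟩ := exists_int_aeval (σ := σ) P fun a => (w a : ℤ)
  have h1 : aeval σ.incidenceEnd (P.map (Int.castRingHom ℝ)) (fun a => (w a : ℝ)) =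
      fun a => (z a : ℝ) := by simpa using hz
  have h2 : σ.incidenceEnd (fun a => (z a : ℝ)) = β • fun a => (z a : ℝ) := by
    rw [kerPolynomial, map_mul, map_sub, aeval_X, aeval_C, Algebra.algebraMap_eq_smul_one,
      Module.End.mul_apply, h1, LinearMap.sub_apply, LinearMap.smul_apply, Module.End.one_apply,
      sub_eq_zero] at hw
    exact hw
  have h3 : ∀ a, z a = 0 := by
    intro a
    -- A non-zero entry of an integer eigenvector would express `β` as the rational number `(M z)_a
    -- / z_a`.
    by_contra hne
    have h4 := congrFun h2 a
    simp only [Substitution.incidenceEnd, toLin'_apply, mulVec, dotProduct, map_apply,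
      Pi.smul_apply, smul_eq_mul] at h4
    refine hβQ ((∑ b, (σ.incidence a b : ℚ) * z b) / z a) ?_
    have h5 : (z a : ℝ) ≠ 0 := by exact_mod_cast hne
    push_cast
    rw [h4]
    field_simp
  -- Pairing `P(M) w = 0` with `y` gives `P(β) (y · w) = 0`, where `y · w` is a sum of non-negative
  -- terms.
  have h6 : y ⬝ᵥ (fun a => (w a : ℝ)) = 0 := by
    have h7 := dotProduct_aeval hyM (P.map (Int.castRingHom ℝ)) (fun a => (w a : ℝ))
    rw [h1] at h7
    have h8 : y ⬝ᵥ (fun a => (z a : ℝ)) = 0 := by simp [h3, dotProduct]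
    rw [h8] at h7
    exact (mul_eq_zero.1 h7.symm).resolve_left hPβ
  have h9 := (Finset.sum_eq_zero_iff_of_nonneg
    (fun a _ => mul_nonneg (hy a).le (Nat.cast_nonneg _))).1 h6 a (Finset.mem_univ a)
  exact_mod_cast (mul_eq_zero.1 h9).resolve_left (hy a).ne'

/-- The images by `V` of the integer vectors in a strip are locally finite. -/
theorem finite_image_strip {E : Type*} [NormedAddCommGroup E] [NormedSpace ℝ E]
    [FiniteDimensional ℝ E] (hσ : σ.IsPrimitive) (hβ0 : 0 ≤ β) (hy : ∀ a, 0 < y a)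
    (hyM : y ᵥ* σ.realMatrix = β • y) {P : ℤ[X]} {V : (A → ℝ) →ₗ[ℝ] E}
    (hV : LinearMap.ker V = LinearMap.ker (aeval σ.incidenceEnd (kerPolynomial β P))) (c r : ℝ) :
    {e : E | ∃ x : A → ℤ, V (fun a => (x a : ℝ)) = e ∧ |y ⬝ᵥ fun a => (x a : ℝ)| ≤ c ∧
      ‖e‖ ≤ r}.Finite := by
  set T : Module.End ℝ (A → ℝ) := aeval σ.incidenceEnd (P.map (Int.castRingHom ℝ)) with hT
  let D : (A → ℝ) →ₗ[ℝ] E × ℝ := V.prod (dotProductBilin ℝ ℝ y)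
  have hD : LinearMap.ker D ≤ LinearMap.ker T := by
    intro x hx
    have hx' : V x = 0 ∧ y ⬝ᵥ x = 0 := by
      have : D x = 0 := hx
      exact ⟨congrArg Prod.fst this, congrArg Prod.snd this⟩
    refine aeval_eq_zero_of_mem hσ hβ0 hy hyM ?_ hx'.2
    have : x ∈ LinearMap.ker V := hx'.1
    rwa [hV] at this
  have hTV : LinearMap.ker T ≤ LinearMap.ker V := by
    intro x hx
    have hx' : T x = 0 := hx
    rw [hV, LinearMap.mem_ker, kerPolynomial, map_mul, Module.End.mul_apply, ← hT, hx', map_zero]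
  -- The vector `P(M) x` is a linear function of `(V x, y · x)`, so it is bounded, and being an
  -- integer vector it takes finitely many values. In turn it determines `V x`, through `H`.
  obtain ⟨G, hG⟩ := exists_factor_of_ker_le hD
  obtain ⟨H, hH⟩ := exists_factor_of_ker_le hTV
  let G' := LinearMap.toContinuousLinearMap G
  set R : ℝ := ‖G'‖ * max r c
  have hfin : {z : A → ℤ | ∀ a, |(z a : ℝ)| ≤ R}.Finite := by
    refine (Set.Finite.pi' fun _ : A => Set.finite_Icc (-⌊R⌋) ⌊R⌋).subset fun z hz a => ?_
    have := abs_le.1 (hz a)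
    exact ⟨neg_le.1 (Int.le_floor.2 (by push_cast; linarith [this.1])), Int.le_floor.2 this.2⟩
  refine (hfin.image fun z => H fun a => (z a : ℝ)).subset ?_
  rintro e ⟨x, rfl, hx, hr⟩
  obtain ⟨z, hz⟩ := exists_int_aeval (σ := σ) P x
  refine ⟨z, fun a => ?_, ?_⟩
  · have h1 : T (fun a => (x a : ℝ)) = G' (D fun a => (x a : ℝ)) := (hG _).symm
    rw [← hT, h1] at hz
    have h2 := norm_le_pi_norm (fun a => (z a : ℝ)) a
    rw [← hz] at h2
    refine (le_of_eq_of_le (Real.norm_eq_abs _).symm h2).trans ((G'.le_opNorm _).trans ?_)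
    refine mul_le_mul_of_nonneg_left ?_ (norm_nonneg _)
    exact max_le_max hr hx
  · simp only
    rw [← hz, ← hT, hH]

end Arithmetic

end

/-! ### Bi-infinite words: prefix sums, and the blocks of the image by the substitution. -/

section Words

variable {A : Type*}

theorem factor_length (u : ℤ → A) (m : ℤ) (n : ℕ) : (factor u m n).length = n := by
  simp [factor]

theorem factor_add (u : ℤ → A) (m : ℤ) (k l : ℕ) :
    factor u m (k + l) = factor u m k ++ factor u (m + k) l := by
  simp only [factor, List.range_add, List.map_append, List.map_map]
  congr 2
  funext i
  simp [add_assoc]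

theorem factor_one (u : ℤ → A) (m : ℤ) : factor u m 1 = [u m] := by
  simp [factor]

/-- The value on `u_{[0,n)}` of a map from words to a group, with the sign convention of
`abPrefix` for negative `n`. -/
def wordSum {G : Type*} [AddGroup G] (h : List A → G) (u : ℤ → A) : ℤ → G
  | .ofNat n => h (factor u 0 n)
  | .negSucc n => -h (factor u (-((n : ℤ) + 1)) (n + 1))

section wordSum

variable {G : Type*} [AddCommGroup G] {h : List A → G}

theorem wordSum_nil (hh : ∀ v w, h (v ++ w) = h v + h w) : h [] = 0 := by simpa using hh [] []

theorem wordSum_natCast (u : ℤ → A) (n : ℕ) : wordSum h u n = h (factor u 0 n) := rfl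

theorem wordSum_neg_natCast (hh : ∀ v w, h (v ++ w) = h v + h w)
    (u : ℤ → A) (n : ℕ) :
    wordSum h u (-(n : ℤ)) = -h (factor u (-(n : ℤ)) n) := by
  cases n with
  | zero =>
    have : wordSum h u (-((0 : ℕ) : ℤ)) = h [] := rfl
    rw [this]
    simp [factor, wordSum_nil hh]
  | succ n => push_cast; rfl

theorem wordSum_zero (hh : ∀ v w, h (v ++ w) = h v + h w) (u : ℤ → A) : wordSum h u 0 = 0 :=
  wordSum_nil hh

theorem wordSum_add_one (hh : ∀ v w, h (v ++ w) = h v + h w)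
    (u : ℤ → A) (m : ℤ) :
    wordSum h u (m + 1) = wordSum h u m + h [u m] := by
  obtain ⟨n, rfl | rfl⟩ := m.eq_nat_or_neg
  · have : ((n : ℤ) + 1) = ((n + 1 : ℕ) : ℤ) := by push_cast; rfl
    rw [this, wordSum_natCast, wordSum_natCast, factor_add, hh, factor_one, zero_add]
  · cases n with
    | zero =>
      have : (-((0 : ℕ) : ℤ) + 1) = ((0 + 1 : ℕ) : ℤ) := by simp
      rw [this, wordSum_natCast, wordSum_neg_natCast hh, factor_add, hh, factor_one]
      simp [factor, wordSum_nil hh]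
    | succ n =>
      have h1 : -((n + 1 : ℕ) : ℤ) + 1 = -(n : ℤ) := by push_cast; ring
      have h2 : factor u (-((n + 1 : ℕ) : ℤ)) (n + 1) =
          [u (-((n + 1 : ℕ) : ℤ))] ++ factor u (-(n : ℤ)) n := by
        rw [add_comm n 1, factor_add, factor_one]
        congr 2
        push_cast; ring
      rw [h1, wordSum_neg_natCast hh, wordSum_neg_natCast hh, h2, hh]
      abel

theorem wordSum_add_natCast (hh : ∀ v w, h (v ++ w) = h v + h w)
    (u : ℤ → A) (m : ℤ) (n : ℕ) :
    wordSum h u (m + n) = wordSum h u m + h (factor u m n) := by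
  induction n with
  | zero => simp [factor, wordSum_nil hh]
  | succ n ih =>
    push_cast
    rw [← add_assoc, wordSum_add_one hh, ih, factor_add, hh, factor_one, add_assoc]

theorem wordSum_shift (hh : ∀ v w, h (v ++ w) = h v + h w) (u : ℤ → A) (m n : ℤ) :
    wordSum h (shiftPow n u) m = wordSum h u (m + n) - wordSum h u n := by
  have hs := wordSum_add_one hh
  induction m using Int.induction_on with
  | zero => simp [wordSum_zero hh]
  | succ m ih =>
    rw [hs, ih, show (m : ℤ) + 1 + n = (m + n) + 1 by ring, hs]
    simp only [shiftPow]; abel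
  | pred m ih =>
    have h1 := hs (shiftPow n u) (-(m : ℤ) - 1)
    have h2 := hs u (-(m : ℤ) - 1 + n)
    rw [sub_add_cancel, ih] at h1
    rw [show -(m : ℤ) - 1 + n + 1 = -m + n by ring] at h2
    simp only [shiftPow] at h1 ⊢
    rw [← add_left_inj, ← h1, h2]
    abel

end wordSum

theorem Substitution.onWord_append (σ : Substitution A) (v w : List A) :
    σ.onWord (v ++ w) = σ.onWord v ++ σ.onWord w := List.flatMap_append

theorem Substitution.onWord_singleton (σ : Substitution A) (a : A) :
    σ.onWord [a] = σ.image a := by simp [Substitution.onWord]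

/-- The position at which `σ(u_m)` begins in `σ(u)`. -/
def Substitution.pos (σ : Substitution A) (u : ℤ → A) : ℤ → ℤ :=
  wordSum (fun w => ((σ.onWord w).length : ℤ)) u

variable (σ : Substitution A)

theorem Substitution.length_append (v w : List A) :
    ((σ.onWord (v ++ w)).length : ℤ) = (σ.onWord v).length + (σ.onWord w).length := by
  rw [σ.onWord_append]; simp

theorem Substitution.pos_zero (u : ℤ → A) : σ.pos u 0 = 0 := wordSum_zero σ.length_append u

theorem Substitution.pos_add_one (u : ℤ → A) (m : ℤ) :
    σ.pos u (m + 1) = σ.pos u m + (σ.image (u m)).length := by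
  rw [← σ.onWord_singleton]; exact wordSum_add_one σ.length_append u m

theorem Substitution.pos_add_natCast (u : ℤ → A) (m : ℤ) (n : ℕ) :
    σ.pos u (m + n) = σ.pos u m + (σ.onWord (factor u m n)).length :=
  wordSum_add_natCast σ.length_append u m n

theorem Substitution.length_image_pos (a : A) : 0 < (σ.image a).length :=
  List.length_pos_of_ne_nil (σ.nonerasing a)

theorem Substitution.strictMono_pos (u : ℤ → A) : StrictMono (σ.pos u) :=
  strictMono_int_of_lt_succ fun m => by
    have := σ.length_image_pos (u m)
    rw [pos_add_one]; omega

theorem Substitution.getElem?_onBiinfinite_natCast (u : ℤ → A) (k n : ℕ)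
    (hk : k < (σ.onWord (factor u 0 n)).length) :
    (σ.onWord (factor u 0 n))[k]? = some (σ.onBiinfinite u k) := by
  have h0 := σ.lt_length_onWord_factor u 0 k
  have h1 : (σ.onWord (factor u 0 (k + 1)))[k]? = some (σ.onBiinfinite u k) :=
    List.getElem?_eq_getElem h0
  rw [← h1]
  rcases le_total n (k + 1) with h | h
  · obtain ⟨l, hl⟩ := Nat.exists_eq_add_of_le h
    rw [hl, factor_add, σ.onWord_append, List.getElem?_append_left hk]
  · obtain ⟨l, rfl⟩ := Nat.exists_eq_add_of_le h
    rw [factor_add, σ.onWord_append, List.getElem?_append_left h0]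

theorem Substitution.getElem?_onBiinfinite_neg (u : ℤ → A) (k n : ℕ)
    (hk : k < (σ.onWord (factor u (-(n : ℤ)) n)).length) :
    (σ.onWord (factor u (-(n : ℤ)) n))[(σ.onWord (factor u (-(n : ℤ)) n)).length - (k + 1)]? =
      some (σ.onBiinfinite u (-((k : ℤ) + 1))) := by
  have h0 := σ.lt_length_onWord_factor u (-(((k + 1 : ℕ)) : ℤ)) k
  have h1 : (σ.onWord (factor u (-((k + 1 : ℕ) : ℤ)) (k + 1)))[
      (σ.onWord (factor u (-((k + 1 : ℕ) : ℤ)) (k + 1))).length - (k + 1)]? =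
      some (σ.onBiinfinite u (-((k : ℤ) + 1))) := List.getElem?_eq_getElem (by omega)
  -- Extending the word to the left does not change the letters counted from its end.
  have key : ∀ n l : ℕ, k < (σ.onWord (factor u (-(n : ℤ)) n)).length →
      (σ.onWord (factor u (-((n + l : ℕ) : ℤ)) (n + l)))[
        (σ.onWord (factor u (-((n + l : ℕ) : ℤ)) (n + l))).length - (k + 1)]? =
      (σ.onWord (factor u (-(n : ℤ)) n))[
        (σ.onWord (factor u (-(n : ℤ)) n)).length - (k + 1)]? := by
    intro n l hk
    have h2 : factor u (-((n + l : ℕ) : ℤ)) (n + l) =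
        factor u (-((n + l : ℕ) : ℤ)) l ++ factor u (-(n : ℤ)) n := by
      rw [add_comm n l, factor_add]
      congr 2
      push_cast; ring
    rw [h2, σ.onWord_append, List.getElem?_append_right (by rw [List.length_append]; omega)]
    congr 1
    rw [List.length_append]; omega
  rw [← h1]
  rcases le_total n (k + 1) with h | h
  · obtain ⟨l, hl⟩ := Nat.exists_eq_add_of_le h
    rw [← key n l hk, ← hl]
  · obtain ⟨l, rfl⟩ := Nat.exists_eq_add_of_le h
    rw [key (k + 1) l h0]

/-- `σ(u)` reads `σ(u_m)` from the position `pos m` on. -/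
theorem Substitution.getElem?_image (u : ℤ → A) (m : ℤ) (j : ℕ)
    (hj : j < (σ.image (u m)).length) :
    (σ.image (u m))[j]? = some (σ.onBiinfinite u (σ.pos u m + j)) := by
  obtain ⟨n, rfl | rfl⟩ := m.eq_nat_or_neg
  · have h1 : σ.pos u (n : ℤ) + j = (((σ.onWord (factor u 0 n)).length + j : ℕ) : ℤ) := by
      push_cast; rfl
    have h2 : σ.onWord (factor u 0 (n + 1)) = σ.onWord (factor u 0 n) ++ σ.image (u n) := by
      rw [factor_add, σ.onWord_append, factor_one, σ.onWord_singleton, zero_add]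
    rw [h1, ← σ.getElem?_onBiinfinite_natCast u _ (n + 1) (by
      rw [h2, List.length_append]; omega), h2, List.getElem?_append_right (by omega)]
    congr 1
    omega
  · cases n with
    | zero =>
      have h2 : σ.onWord (factor u 0 1) = σ.image (u 0) := by
        rw [factor_one, σ.onWord_singleton]
      simp only [Nat.cast_zero, neg_zero, σ.pos_zero, zero_add] at hj ⊢
      rw [← σ.getElem?_onBiinfinite_natCast u j 1 (by rwa [h2]), h2]
    | succ n =>
      have h2 : factor u (-((n + 1 : ℕ) : ℤ)) (n + 1) =
          [u (-((n + 1 : ℕ) : ℤ))] ++ factor u (-(n : ℤ)) n := by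
        rw [add_comm n 1, factor_add, factor_one]
        congr 2
        push_cast; ring
      set w := σ.onWord (factor u (-((n + 1 : ℕ) : ℤ)) (n + 1)) with hw
      have h3 : w = σ.image (u (-((n + 1 : ℕ) : ℤ))) ++ σ.onWord (factor u (-(n : ℤ)) n) := by
        rw [hw, h2, σ.onWord_append, σ.onWord_singleton]
      have h4 : j < w.length := by rw [h3, List.length_append]; omega
      have h5 : σ.pos u (-((n + 1 : ℕ) : ℤ)) = -(w.length : ℤ) :=
        wordSum_neg_natCast σ.length_append u (n + 1)
      have h6 := σ.getElem?_onBiinfinite_neg u (w.length - j - 1) (n + 1) (by rw [← hw]; omega)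
      rw [← hw] at h6
      have h7 : -(((w.length - j - 1 : ℕ) : ℤ) + 1) = σ.pos u (-((n + 1 : ℕ) : ℤ)) + j := by
        rw [h5]; omega
      rw [h7] at h6
      rw [← h6, show w.length - (w.length - j - 1 + 1) = j by omega, h3,
        List.getElem?_append_left hj]

theorem Substitution.le_pos (u : ℤ → A) {m : ℤ} (hm : 0 ≤ m) : m ≤ σ.pos u m := by
  obtain ⟨n, rfl⟩ := Int.eq_ofNat_of_zero_le hm
  clear hm
  induction n with
  | zero => simp [σ.pos_zero]
  | succ n ih =>
    have := σ.strictMono_pos u (show (n : ℤ) < ((n + 1 : ℕ) : ℤ) by push_cast; omega)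
    push_cast at *
    omega

theorem Substitution.pos_le (u : ℤ → A) {m : ℤ} (hm : m ≤ 0) : σ.pos u m ≤ m := by
  obtain ⟨n, hn⟩ := Int.eq_ofNat_of_zero_le (neg_nonneg.2 hm)
  rw [neg_eq_iff_eq_neg] at hn
  subst hn
  clear hm
  induction n with
  | zero => simp [σ.pos_zero]
  | succ n ih =>
    have := σ.strictMono_pos u (show (-((n + 1 : ℕ) : ℤ)) < -(n : ℤ) by push_cast; omega)
    push_cast at *
    omega

/-- Every position of `σ(u)` lies in a block `σ(u_m)`. -/
theorem Substitution.exists_pos_add (u : ℤ → A) (k : ℤ) : ∃ (m : ℤ) (j : ℕ),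
    j < (σ.image (u m)).length ∧ k = σ.pos u m + j := by
  have hex : ∃ m, k < σ.pos u (m + 1) ∧ σ.pos u m ≤ k := by
    obtain ⟨m, hm1, hm2⟩ := Int.exists_greatest_of_bdd (P := fun m => σ.pos u m ≤ k)
      ⟨max k 0, fun z hz => by
        by_contra! hcon
        have := σ.le_pos u (m := z) (by omega)
        omega⟩
      ⟨min k 0, by
        have := σ.pos_le u (m := min k 0) (by omega)
        omega⟩
    exact ⟨m, by by_contra! hcon; exact absurd (hm2 _ hcon) (by omega), hm1⟩
  obtain ⟨m, h1, h2⟩ := hex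
  rw [pos_add_one] at h1
  exact ⟨m, (k - σ.pos u m).toNat, by omega, by omega⟩

theorem Substitution.pos_shift (u : ℤ → A) (m n : ℤ) :
    σ.pos (shiftPow n u) m = σ.pos u (m + n) - σ.pos u n :=
  wordSum_shift σ.length_append u m n

/-- `σ ∘ S^n` is a power of the shift after `σ`. -/
theorem Substitution.onBiinfinite_shiftPow (u : ℤ → A) (n : ℤ) :
    σ.onBiinfinite (shiftPow n u) = shiftPow (σ.pos u n) (σ.onBiinfinite u) := by
  funext k
  obtain ⟨m, j, hj, rfl⟩ := σ.exists_pos_add (shiftPow n u) k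
  have h1 := σ.getElem?_image (shiftPow n u) m j hj
  have h2 := σ.getElem?_image u (m + n) j hj
  rw [show shiftPow n u m = u (m + n) from rfl, h2, Option.some_inj] at h1
  rw [← h1]
  simp only [shiftPow]
  congr 1
  have := σ.pos_shift u m n
  rw [this]; ring

theorem shiftPow_add (u : ℤ → A) (m n : ℤ) :
    shiftPow m (shiftPow n u) = shiftPow (m + n) u := by
  funext i; simp only [shiftPow]; congr 1; ring

theorem shiftPow_zero (u : ℤ → A) : shiftPow 0 u = u := by
  funext i; simp [shiftPow]

theorem factor_shiftPow (u : ℤ → A) (m n : ℤ) (l : ℕ) :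
    factor (shiftPow n u) m l = factor u (m + n) l := by
  simp only [factor, shiftPow]
  congr 1
  funext i
  congr 1
  ring

theorem factor_take (u : ℤ → A) (m : ℤ) {k l : ℕ} (h : k ≤ l) :
    (factor u m l).take k = factor u m k := by
  obtain ⟨j, rfl⟩ := Nat.exists_eq_add_of_le h
  rw [factor_add, List.take_append_of_le_length (by rw [factor_length]), List.take_of_length_le
    (by rw [factor_length])]

/-- The word `σ(u_m)` is the factor of `σ(u)` at the position `pos m`. -/
theorem Substitution.factor_onBiinfinite_image (u : ℤ → A) (m : ℤ) :
    factor (σ.onBiinfinite u) (σ.pos u m) (σ.image (u m)).length = σ.image (u m) := by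
  apply List.ext_getElem?
  intro j
  by_cases hj : j < (σ.image (u m)).length
  · rw [σ.getElem?_image u m j hj]
    simp [factor, hj]
  · rw [List.getElem?_eq_none (by rw [factor_length]; omega), List.getElem?_eq_none (by omega)]

theorem Substitution.factor_onBiinfinite (u : ℤ → A) (m : ℤ) (n : ℕ) :
    factor (σ.onBiinfinite u) (σ.pos u m) (σ.onWord (factor u m n)).length =
      σ.onWord (factor u m n) := by
  induction n with
  | zero => simp [factor, Substitution.onWord]
  | succ n ih =>
    rw [factor_add, σ.onWord_append, List.length_append, factor_add, ih, factor_one,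
      σ.onWord_singleton, ← σ.pos_add_natCast, σ.factor_onBiinfinite_image]

section Ab

variable [DecidableEq A]

theorem ab_append (v w : List A) : ab (v ++ w) = ab v + ab w := by
  funext a; simp [ab]

theorem ab_nil : ab ([] : List A) = 0 := by
  funext a; simp [ab]

theorem ab_singleton (a : A) : ab [a] = Pi.single a 1 := by
  funext b
  by_cases h : b = a
  · subst h; simp [ab]
  · simp [ab, h, Ne.symm h]

theorem abPrefix_eq_wordSum (u : ℤ → A) : abPrefix u = wordSum ab u := by
  funext n; cases n <;> rfl

theorem abPrefix_zero (u : ℤ → A) : abPrefix u 0 = 0 := by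
  rw [abPrefix_eq_wordSum, wordSum_zero ab_append]

theorem abPrefix_add_natCast (u : ℤ → A) (m : ℤ) (n : ℕ) :
    abPrefix u (m + n) = abPrefix u m + ab (factor u m n) := by
  rw [abPrefix_eq_wordSum, wordSum_add_natCast ab_append]

theorem abPrefix_add_one (u : ℤ → A) (m : ℤ) :
    abPrefix u (m + 1) = abPrefix u m + Pi.single (u m) 1 := by
  rw [abPrefix_eq_wordSum, wordSum_add_one ab_append, ab_singleton]

theorem abPrefix_shift (u : ℤ → A) (m n : ℤ) :
    abPrefix (shiftPow n u) m = abPrefix u (m + n) - abPrefix u n := by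
  rw [abPrefix_eq_wordSum, abPrefix_eq_wordSum, wordSum_shift ab_append]

variable [Fintype A]

theorem Substitution.ab_onWord (w : List A) : ab (σ.onWord w) = σ.incidenceEnd (ab w) := by
  induction w with
  | nil => simp [Substitution.onWord, ab_nil]
  | cons a w ih =>
    rw [← List.singleton_append, σ.onWord_append, ab_append, ab_append, map_add, ih,
      σ.onWord_singleton, ab_singleton]
    congr 1
    funext b
    simp [Substitution.incidenceEnd, Substitution.incidence, ab]

theorem Substitution.ab_image (a : A) : ab (σ.image a) = σ.incidenceEnd (Pi.single a 1) := by
  rw [← σ.onWord_singleton, σ.ab_onWord, ab_singleton]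

theorem Substitution.abPrefix_pos (u : ℤ → A) (m : ℤ) :
    abPrefix (σ.onBiinfinite u) (σ.pos u m) = σ.incidenceEnd (abPrefix u m) := by
  have h : ∀ m, abPrefix (σ.onBiinfinite u) (σ.pos u (m + 1)) =
      abPrefix (σ.onBiinfinite u) (σ.pos u m) + σ.incidenceEnd (Pi.single (u m) 1) := fun m => by
    rw [σ.pos_add_one, abPrefix_add_natCast, σ.factor_onBiinfinite_image, σ.ab_image]
  induction m using Int.induction_on with
  | zero => simp [σ.pos_zero, abPrefix_zero]
  | succ m ih => rw [h, ih, abPrefix_add_one, map_add]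
  | pred m ih =>
    have h1 := h (-(m : ℤ) - 1)
    have h2 := abPrefix_add_one u (-(m : ℤ) - 1)
    rw [sub_add_cancel] at h1 h2
    rw [ih, h2, map_add] at h1
    exact (add_right_cancel h1).symm

end Ab

end Words

/-! ### The subshift: factors, compactness, desubstitution. -/

section Dynamics

variable {A : Type*}

theorem factor_eq_iff {u v : ℤ → A} {m n : ℤ} {l : ℕ} :
    factor u m l = factor v n l ↔ ∀ i < l, u (m + (i : ℕ)) = v (n + (i : ℕ)) := by
  simp [factor, List.map_inj_left]

theorem factor_sub {u v : ℤ → A} {m n : ℤ} {L : ℕ} (h : factor u m L = factor v n L) {i l : ℕ}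
    (hl : i + l ≤ L) : factor u (m + i) l = factor v (n + i) l := by
  rw [factor_eq_iff] at h ⊢
  intro j hj
  have := h (i + j) (by omega)
  push_cast at this
  rwa [← add_assoc, ← add_assoc] at this

theorem shiftPow_mem_of_image_eq {K : Set (ℤ → A)} (hK : shiftPow 1 '' K = K) {v : ℤ → A}
    (hv : v ∈ K) (n : ℤ) : shiftPow n v ∈ K := by
  induction n using Int.induction_on with
  | zero => rwa [shiftPow_zero]
  | succ n ih =>
    rw [add_comm, ← shiftPow_add, ← hK]
    exact ⟨_, ih, rfl⟩
  | pred n ih =>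
    rw [← hK] at ih
    obtain ⟨w, hw, hw'⟩ := ih
    have : shiftPow (-(n : ℤ) - 1) v = w := by
      rw [sub_eq_add_neg, add_comm, ← shiftPow_add, ← hw', shiftPow_add, neg_add_cancel,
        shiftPow_zero]
    rwa [this]

theorem shiftPow_image_eq {K : Set (ℤ → A)} (hK : ∀ v ∈ K, ∀ n, shiftPow n v ∈ K) :
    shiftPow 1 '' K = K := by
  refine Set.Subset.antisymm (Set.image_subset_iff.2 fun v hv => hK v hv 1) fun v hv =>
    ⟨shiftPow (-1) v, hK v hv _, ?_⟩
  rw [shiftPow_add, add_neg_cancel, shiftPow_zero]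

section Iterate

variable {σ : Substitution A} {u : ℤ → A}

theorem iterate_pos_zero (k : ℕ) : (σ.pos u)^[k] 0 = 0 := by
  induction k with
  | zero => rfl
  | succ k ih => rw [Function.iterate_succ_apply, σ.pos_zero, ih]

/-- Equal factors have equal images by the substitution, and these images are again factors of the
fixed point; this is iterated. -/
theorem factor_iterate_pos (hfix : σ.onBiinfinite u = u) (k : ℕ) : ∀ (m m' : ℤ) (l : ℕ),
    factor u m l = factor u m' l → ∃ L : ℕ, (σ.pos u)^[k] (m + l) = (σ.pos u)^[k] m + L ∧
      (σ.pos u)^[k] (m' + l) = (σ.pos u)^[k] m' + L ∧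
      factor u ((σ.pos u)^[k] m) L = factor u ((σ.pos u)^[k] m') L := by
  induction k with
  | zero => exact fun m m' l h => ⟨l, rfl, rfl, h⟩
  | succ k ih =>
    intro m m' l h
    simp only [Function.iterate_succ_apply]
    have h1 := σ.factor_onBiinfinite u m l
    have h2 := σ.factor_onBiinfinite u m' l
    rw [hfix] at h1 h2
    rw [σ.pos_add_natCast, σ.pos_add_natCast, ← h]
    refine ih _ _ _ ?_
    rw [h1, h, h2]

theorem strictMono_iterate_pos (k : ℕ) : StrictMono ((σ.pos u)^[k]) :=
  (σ.strictMono_pos u).iterate k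

/-- The positions `(σ.pos u)^[k] m` cut the fixed point into the blocks `σ^k(u_m)`, of bounded
length since the alphabet is finite. -/
theorem exists_gap [Finite A] (k : ℕ) : ∃ G : ℕ, ∀ m : ℤ,
    (σ.pos u)^[k] (m + 1) ≤ (σ.pos u)^[k] m + G := by
  have := Fintype.ofFinite A
  obtain ⟨B, hB⟩ : ∃ B : ℕ, ∀ a, (σ.image a).length ≤ B :=
    ⟨∑ a, (σ.image a).length, fun a =>
      Finset.single_le_sum (f := fun a => (σ.image a).length) (fun _ _ => Nat.zero_le _)
        (Finset.mem_univ a)⟩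
  have h1 : ∀ (n : ℕ) (m : ℤ), σ.pos u (m + n) ≤ σ.pos u m + B * n := by
    intro n m
    induction n with
    | zero => simp
    | succ n ih =>
      have := hB (u (m + n))
      push_cast
      rw [← add_assoc, σ.pos_add_one, mul_add]
      omega
  induction k with
  | zero => exact ⟨1, fun m => le_rfl⟩
  | succ k ih =>
    obtain ⟨G, hG⟩ := ih
    refine ⟨B * G, fun m => ?_⟩
    simp only [Function.iterate_succ_apply']
    push_cast
    exact ((σ.strictMono_pos u).monotone (hG m)).trans (h1 G _)

theorem exists_iterate_pos_le (k : ℕ) (j : ℤ) : ∃ m : ℤ,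
    (σ.pos u)^[k] m ≤ j ∧ j < (σ.pos u)^[k] (m + 1) := by
  induction k generalizing j with
  | zero => exact ⟨j, le_rfl, by simp⟩
  | succ k ih =>
    obtain ⟨q, i, hi, rfl⟩ := σ.exists_pos_add u j
    obtain ⟨m, h1, h2⟩ := ih q
    have hmono := (σ.strictMono_pos u).monotone
    have h3 := hmono h1
    have h4 := hmono (Int.add_one_le_iff.2 h2)
    rw [σ.pos_add_one] at h4
    refine ⟨m, ?_, ?_⟩ <;> simp only [Function.iterate_succ_apply'] <;> omega

end Iterate

variable [TopologicalSpace A]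

theorem continuous_shiftPow (n : ℤ) : Continuous (shiftPow n : (ℤ → A) → ℤ → A) :=
  continuous_pi fun i => continuous_apply (i + n)

theorem Substitution.mapsTo_subshift (σ : Substitution A) :
    Set.MapsTo σ.onBiinfinite σ.subshift σ.subshift :=
  fun _ hv K hK => hK.2.2.2 (hv K hK)

theorem Substitution.shiftPow_mem_subshift (σ : Substitution A) {v : ℤ → A} (hv : v ∈ σ.subshift)
    (n : ℤ) :
    shiftPow n v ∈ σ.subshift :=
  fun K hK => shiftPow_mem_of_image_eq hK.2.2.1 (hv K hK) n

variable [DiscreteTopology A]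

theorem eventually_factor_eq (u : ℤ → A) (m : ℤ) (l : ℕ) :
    ∀ᶠ v in 𝓝 u, factor v m l = factor u m l := by
  have h : ∀ i ∈ Finset.range l, ∀ᶠ v in 𝓝 u, v (m + (i : ℕ)) = u (m + (i : ℕ)) := fun i _ =>
    (continuous_apply (m + (i : ℕ) : ℤ)).continuousAt.eventually
      (show ∀ᶠ x in 𝓝 (u (m + (i : ℕ))), x = u (m + (i : ℕ)) by rw [nhds_discrete]; simp)
  filter_upwards [(Filter.eventually_all_finset _).2 h] with v hv
  exact factor_eq_iff.2 fun i hi => hv i (Finset.mem_range.2 hi)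

theorem mem_closure_iff_factor {S : Set (ℤ → A)} {v : ℤ → A} :
    v ∈ closure S ↔ ∀ (m : ℤ) (l : ℕ), ∃ w ∈ S, factor w m l = factor v m l := by
  constructor
  · intro h m l
    obtain ⟨w, hw1, hw2⟩ := (mem_closure_iff_nhds.1 h) _ (eventually_factor_eq v m l)
    exact ⟨w, hw2, hw1⟩
  · intro h
    rw [mem_closure_iff]
    intro o ho hv
    obtain ⟨I, s, hs, hsub⟩ := isOpen_pi_iff.1 ho v hv
    obtain ⟨N, hN⟩ : ∃ N : ℕ, ∀ i ∈ I, |i| ≤ N := by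
      refine ⟨I.sup fun i => i.natAbs, fun i hi => ?_⟩
      have := Finset.le_sup (f := fun i : ℤ => i.natAbs) hi
      rw [Int.abs_eq_natAbs]
      exact_mod_cast this
    obtain ⟨w, hw, hwv⟩ := h (-(N : ℤ)) (2 * N + 1)
    refine ⟨w, hsub fun i hi => ?_, hw⟩
    have h1 := abs_le.1 (hN i hi)
    have h2 := factor_eq_iff.1 hwv (i + N).toNat (by omega)
    rw [Int.toNat_of_nonneg (by omega), neg_add_cancel_comm_assoc] at h2
    rw [h2]
    exact (hs i hi).2

theorem Substitution.continuous_onBiinfinite (σ : Substitution A) :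
    Continuous σ.onBiinfinite := by
  refine continuous_pi fun k => continuous_iff_continuousAt.2 fun u => ?_
  refine tendsto_nhds_of_eventually_eq ?_
  obtain ⟨n, rfl | ⟨rfl⟩⟩ : ∃ n : ℕ, k = n ∨ k = -((n : ℤ) + 1) := by
    rcases k with n | n
    · exact ⟨n, Or.inl rfl⟩
    · exact ⟨n, Or.inr rfl⟩
  · filter_upwards [eventually_factor_eq u 0 (n + 1)] with v hv
    have h1 := σ.getElem?_onBiinfinite_natCast v n _ (σ.lt_length_onWord_factor v 0 n)
    have h2 := σ.getElem?_onBiinfinite_natCast u n _ (σ.lt_length_onWord_factor u 0 n)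
    rw [hv, h2] at h1
    exact (Option.some_inj.1 h1).symm
  · filter_upwards [eventually_factor_eq u (-((n + 1 : ℕ) : ℤ)) (n + 1)] with v hv
    have h1 := σ.getElem?_onBiinfinite_neg v n (n + 1) (σ.lt_length_onWord_factor v _ n)
    have h2 := σ.getElem?_onBiinfinite_neg u n (n + 1) (σ.lt_length_onWord_factor u _ n)
    rw [hv, h2] at h1
    exact (Option.some_inj.1 h1).symm

variable (σ : Substitution A)

theorem Substitution.isClosed_subshift : IsClosed σ.subshift :=
  isClosed_sInter fun _ hK => hK.2.1.isClosed

variable [Finite A] {σ} {u : ℤ → A}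

theorem Substitution.isCompact_subshift : IsCompact σ.subshift :=
  σ.isClosed_subshift.isCompact

/-- The orbit closure of the fixed point is one of the sets whose intersection defines the subshift.
-/
theorem subshift_subset_closure_orbit (hfix : σ.onBiinfinite u = u) :
    σ.subshift ⊆ closure (Set.range fun n : ℤ => shiftPow n u) := by
  refine Set.sInter_subset_of_mem ⟨⟨u, subset_closure ⟨0, shiftPow_zero u⟩⟩,
    isClosed_closure.isCompact, shiftPow_image_eq fun v hv n => ?_, ?_⟩
  · refine map_mem_closure (continuous_shiftPow n) hv ?_
    rintro _ ⟨m, rfl⟩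
    exact ⟨n + m, (shiftPow_add u n m).symm⟩
  · intro v hv
    refine map_mem_closure σ.continuous_onBiinfinite hv ?_
    rintro _ ⟨m, rfl⟩
    exact ⟨σ.pos u m, by simp only; rw [σ.onBiinfinite_shiftPow, hfix]⟩

/-- Every factor of a point of the subshift occurs in the fixed point, at a nonnegative index. -/
theorem exists_factor_eq (hfix : σ.onBiinfinite u = u) {v : ℤ → A} (hv : v ∈ σ.subshift) (m : ℤ)
    (l : ℕ) : ∃ j : ℤ, 0 ≤ j ∧ factor u j l = factor v m l := by
  -- `X` competes in the definition of the subshift. It is non-empty by a cluster point of `S^k u`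
  -- as `k → +∞`, which is what makes non-negative indices available; `exists_recurrence` needs
  -- them.
  set X : Set (ℤ → A) := {v | ∀ (m : ℤ) (l : ℕ), ∃ j : ℤ, 0 ≤ j ∧ factor u j l = factor v m l}
  suffices h : σ.subshift ⊆ X from h hv m l
  refine Set.sInter_subset_of_mem ⟨?_, ?_, shiftPow_image_eq fun v hv n m l => ?_, ?_⟩
  · obtain ⟨x, -, hx⟩ := isCompact_univ.exists_mapClusterPt (f := atTop)
      (u := fun k : ℕ => shiftPow (k : ℤ) u) (by simp)
    refine ⟨x, fun m l => ?_⟩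
    obtain ⟨k, hk1, hk2⟩ := ((hx.frequently (eventually_factor_eq x m l)).and_eventually
      (eventually_ge_atTop m.natAbs)).exists
    rw [factor_shiftPow] at hk1
    exact ⟨m + k, by omega, hk1⟩
  · refine IsClosed.isCompact (isClosed_of_closure_subset fun v hv m l => ?_)
    obtain ⟨w, hw, hwv⟩ := mem_closure_iff_factor.1 hv m l
    obtain ⟨j, hj, hj'⟩ := hw m l
    exact ⟨j, hj, hj'.trans hwv⟩
  · rw [factor_shiftPow]; exact hv _ _
  · intro v hv m l
    obtain ⟨m₁, j₁, hj₁, h₁⟩ := σ.exists_pos_add v m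
    obtain ⟨m₂, j₂, hj₂, h₂⟩ := σ.exists_pos_add v (m + l)
    have hmono := σ.strictMono_pos v
    have h3 := σ.pos_add_one v m₂
    have h4 : m₁ < m₂ + 1 := hmono.lt_iff_lt.1 (by omega)
    obtain ⟨n, hn⟩ := Int.eq_ofNat_of_zero_le (show 0 ≤ m₂ + 1 - m₁ by omega)
    obtain ⟨j, hj0, hj⟩ := hv m₁ n
    have h5 := σ.factor_onBiinfinite v m₁ n
    have h6 := σ.factor_onBiinfinite u j n
    have h7 := σ.pos_add_natCast v m₁ n
    rw [hj, hfix] at h6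
    have h8 := (σ.strictMono_pos u).monotone hj0
    rw [σ.pos_zero] at h8
    refine ⟨σ.pos u j + j₁, by omega, ?_⟩
    rw [h₁]
    rw [show m₁ + (n : ℤ) = m₂ + 1 by omega] at h7
    exact factor_sub (i := j₁) (l := l) (h6.trans h5.symm) (by omega)

/-- Desubstitution: the subshift is the union of the shifted images of its points. -/
theorem exists_desubstitution (hu : u ∈ σ.subshift) (hfix : σ.onBiinfinite u = u) {v : ℤ → A}
    (hv : v ∈ σ.subshift) : ∃ w ∈ σ.subshift, ∃ j : ℕ, j < (σ.image (w 0)).length ∧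
      v = shiftPow j (σ.onBiinfinite w) := by
  -- `C` is the set of desubstitutable points. It is a finite union of continuous images of compact
  -- sets, hence closed, and it contains the orbit of `u`.
  set C : Set (ℤ → A) := ⋃ x ∈ {x : A × ℕ | x.2 < (σ.image x.1).length},
    (fun w => shiftPow (x.2 : ℤ) (σ.onBiinfinite w)) '' (σ.subshift ∩ {w | w 0 = x.1})
  have hfin : {x : A × ℕ | x.2 < (σ.image x.1).length}.Finite := by
    have : {x : A × ℕ | x.2 < (σ.image x.1).length} =
        ⋃ a : A, (fun n => (a, n)) '' Set.Iio (σ.image a).length := by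
      ext ⟨a, n⟩
      simp
    rw [this]
    exact Set.finite_iUnion fun a => (Set.finite_Iio _).image _
  have hC : IsCompact C := hfin.isCompact_biUnion fun x _ =>
    ((Substitution.isCompact_subshift (σ := σ)).inter_right
      ((isClosed_discrete ({x.1} : Set A)).preimage
      (continuous_apply (0 : ℤ) : Continuous fun w : ℤ → A => w 0))).image
      ((continuous_shiftPow (x.2 : ℤ)).comp σ.continuous_onBiinfinite)
  have hsub : closure (Set.range fun n : ℤ => shiftPow n u) ⊆ C := by
    refine closure_minimal ?_ hC.isClosed
    rintro _ ⟨n, rfl⟩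
    obtain ⟨m, j, hj, rfl⟩ := σ.exists_pos_add u n
    refine Set.mem_iUnion₂.2 ⟨(u m, j), hj, shiftPow m u,
      ⟨σ.shiftPow_mem_subshift hu m, by simp [shiftPow]⟩, ?_⟩
    simp only
    rw [σ.onBiinfinite_shiftPow, hfix, shiftPow_add, add_comm]
  obtain ⟨⟨a, j⟩, hj, w, ⟨hw, hwa⟩, rfl⟩ := Set.mem_iUnion₂.1
    (hsub (subshift_subset_closure_orbit hfix hv))
  have hwa' : w 0 = a := hwa
  exact ⟨w, hw, j, by rw [hwa']; exact hj, rfl⟩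

end Dynamics

/-! ### Primitivity and minimality of the subshift. -/

section Recurrence

variable {A : Type*} [Fintype A] [DecidableEq A] {σ : Substitution A} {u : ℤ → A}

theorem abPrefix_iterate_pos (hfix : σ.onBiinfinite u = u) (k : ℕ) (m : ℤ) :
    abPrefix u ((σ.pos u)^[k] m) = (σ.incidenceEnd ^ k) (abPrefix u m) := by
  induction k with
  | zero => rfl
  | succ k ih =>
    have h := σ.abPrefix_pos u ((σ.pos u)^[k] m)
    rw [hfix, ih] at h
    rw [Function.iterate_succ_apply', h, pow_succ', Module.End.mul_apply]

/-- The number of letters `a` in `σ^k(u_m)` is the entry `(a, u_m)` of `M^k`, positive for a `k`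
independent of `m`. -/
theorem exists_letter (hσ : σ.IsPrimitive) (hfix : σ.onBiinfinite u = u) (a : A) :
    ∃ k : ℕ, ∀ m : ℤ, ∃ m' : ℤ, (σ.pos u)^[k] m ≤ m' ∧ m' < (σ.pos u)^[k] (m + 1) ∧
      u m' = a := by
  obtain ⟨k, -, hk⟩ := hσ.exists_pos_pow
  refine ⟨k, fun m => ?_⟩
  obtain ⟨L, hL⟩ := Int.eq_ofNat_of_zero_le (sub_nonneg.2
    ((strictMono_iterate_pos (σ := σ) (u := u) k).monotone (by simp : m ≤ m + 1)))
  have hL' : (σ.pos u)^[k] (m + 1) = (σ.pos u)^[k] m + L := by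
    rw [← sub_eq_iff_eq_add']; exact hL
  have h1 : ab (factor u ((σ.pos u)^[k] m) L) = (σ.incidenceEnd ^ k) (Pi.single (u m) 1) := by
    have h2 := abPrefix_add_natCast u ((σ.pos u)^[k] m) L
    rw [← hL', abPrefix_iterate_pos hfix, abPrefix_iterate_pos hfix, abPrefix_add_one,
      map_add] at h2
    exact (add_left_cancel h2).symm
  have h3 : 0 < ab (factor u ((σ.pos u)^[k] m) L) a := by
    rw [h1, Substitution.incidenceEnd, ← Matrix.toLin'_pow, Matrix.toLin'_apply,
      Matrix.mulVec_single_one]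
    exact hk a (u m)
  have h4 : a ∈ factor u ((σ.pos u)^[k] m) L := by
    rw [← List.count_pos_iff]
    unfold ab at h3
    exact_mod_cast h3
  simp only [factor, List.mem_map, List.mem_range] at h4
  obtain ⟨i, hi, hia⟩ := h4
  exact ⟨_, by omega, by omega, hia⟩

open Matrix in
-- Give each letter `b` the weight `y b`. The word `σ^k(u_0)` weighs `β^k y(u_0)`, which is
-- unbounded, while a word weighs at most a constant times its length.
theorem exists_iterate_pos_ge {β : ℝ} {y : A → ℝ} (hβ : 1 < β) (hy : ∀ a, 0 < y a)
    (hyM : y ᵥ* σ.realMatrix = β • y) (hfix : σ.onBiinfinite u = u) (L : ℤ) :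
    ∃ k : ℕ, L ≤ (σ.pos u)^[k] 1 := by
  have hsum : ∀ a, y a ≤ ∑ b, y b := fun a =>
    Finset.single_le_sum (fun b _ => (hy b).le) (Finset.mem_univ a)
  have hS : 0 < ∑ b, y b := (hy (u 0)).trans_le (hsum _)
  have h1 : ∀ n : ℕ, y ⬝ᵥ abPrefix u n ≤ n * ∑ b, y b := by
    intro n
    induction n with
    | zero => simp [abPrefix_zero]
    | succ n ih =>
      push_cast
      rw [abPrefix_add_one, dotProduct_add, dotProduct_single_one]
      linarith [hsum (u n)]
  have h2 : ∀ k : ℕ, y ⬝ᵥ abPrefix u ((σ.pos u)^[k] 1) = β ^ k * y (u 0) := by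
    intro k
    have h3 := dotProduct_aeval hyM (X ^ k) (abPrefix u 1)
    have h4 := abPrefix_add_one u 0
    rw [zero_add, abPrefix_zero, zero_add] at h4
    rw [aeval_X_pow, eval_pow, eval_X, ← abPrefix_iterate_pos hfix, h4,
      dotProduct_single_one] at h3
    exact h3
  obtain ⟨k, hk⟩ := pow_unbounded_of_one_lt ((|L| : ℤ) * (∑ b, y b) / y (u 0)) hβ
  refine ⟨k, ?_⟩
  rw [div_lt_iff₀ (hy _), ← h2] at hk
  have hnn : 0 ≤ (σ.pos u)^[k] 1 := by
    rw [← iterate_pos_zero (σ := σ) (u := u) k]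
    exact (strictMono_iterate_pos k).monotone zero_le_one
  obtain ⟨n, hn⟩ := Int.eq_ofNat_of_zero_le hnn
  rw [hn] at hk ⊢
  have h5 := lt_of_mul_lt_mul_right (hk.trans_le (h1 n)) hS.le
  have h6 : |L| < n := by exact_mod_cast h5
  have := le_abs_self L
  omega

/-- Uniform recurrence of the fixed point. -/
theorem exists_recurrence {β : ℝ} {y : A → ℝ} (hσ : σ.IsPrimitive) (hβ : 1 < β)
    (hy : ∀ a, 0 < y a) (hyM : Matrix.vecMul y σ.realMatrix = β • y)
    (hfix : σ.onBiinfinite u = u) {m : ℤ} (hm : 0 ≤ m) (l : ℕ) :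
    ∃ G : ℕ, ∀ j : ℤ, ∃ i : ℤ, j ≤ i ∧ i + l ≤ j + G ∧ factor u i l = factor u m l := by
  -- The factor sits inside `σ^n(u_0)`, and the letter `u_0` occurs in every `σ^k`-block, so the
  -- factor occurs in every `σ^(n+k)`-block. The window starting at `j` must contain the block
  -- following that of `j`, whence `2 * G`.
  obtain ⟨n, hn⟩ := exists_iterate_pos_ge hβ hy hyM hfix (m + l)
  obtain ⟨k, hk⟩ := exists_letter hσ hfix (u 0)
  obtain ⟨G, hG⟩ := exists_gap (σ := σ) (u := u) (n + k)
  refine ⟨2 * G, fun j => ?_⟩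
  obtain ⟨m₁, h1, h2⟩ := exists_iterate_pos_le (σ := σ) (u := u) (n + k) j
  obtain ⟨m', h3, h4, h5⟩ := hk (m₁ + 1)
  obtain ⟨L, hL1, hL2, hL3⟩ := factor_iterate_pos hfix n m' 0 1 (by
    rw [factor_one, factor_one, h5])
  have hmono : Monotone ((σ.pos u)^[n]) := (strictMono_iterate_pos n).monotone
  have h6 := hmono h3
  have h7 := hmono (Int.add_one_le_iff.2 h4)
  rw [← Function.iterate_add_apply] at h6 h7
  have h8 := hG m₁
  have h9 := hG (m₁ + 1)
  rw [iterate_pos_zero] at hL2 hL3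
  simp only [Nat.cast_one, zero_add] at hL1 hL2
  obtain ⟨i, rfl⟩ := Int.eq_ofNat_of_zero_le hm
  refine ⟨(σ.pos u)^[n] m' + i, by omega, by push_cast; omega, ?_⟩
  have := factor_sub hL3 (i := i) (l := l) (by omega)
  rwa [zero_add] at this

/-- The subshift is minimal: the fixed point is in every orbit closure. -/
theorem mem_closure_orbit [TopologicalSpace A] [DiscreteTopology A] {β : ℝ} {y : A → ℝ}
    (hσ : σ.IsPrimitive) (hβ : 1 < β) (hy : ∀ a, 0 < y a)
    (hyM : Matrix.vecMul y σ.realMatrix = β • y) (hu : u ∈ σ.subshift)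
    (hfix : σ.onBiinfinite u = u) {v : ℤ → A} (hv : v ∈ σ.subshift) :
    u ∈ closure (Set.range fun n : ℤ => shiftPow n v) := by
  rw [mem_closure_iff_factor]
  intro m l
  obtain ⟨j, hj, hjm⟩ := exists_factor_eq hfix hu m l
  obtain ⟨G, hG⟩ := exists_recurrence hσ hβ hy hyM hfix hj l
  -- A window of length `G` of `v` is a factor of `u`, so it contains the wanted factor by uniform
  -- recurrence.
  obtain ⟨j₀, -, hj₀⟩ := exists_factor_eq hfix hv 0 G
  obtain ⟨i, h1, h2, h3⟩ := hG j₀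
  obtain ⟨r, hr⟩ := Int.eq_ofNat_of_zero_le (sub_nonneg.2 h1)
  have h4 := factor_sub hj₀ (i := r) (l := l) (by omega)
  refine ⟨_, ⟨r - m, rfl⟩, ?_⟩
  rw [factor_shiftPow, add_sub_cancel, ← hjm, ← h3]
  rw [show j₀ + (r : ℤ) = i by omega, zero_add] at h4
  exact h4.symm

end Recurrence

/-! ### Boundedness of the projected worm. -/

section Bounded

variable {E : Type*} [NormedAddCommGroup E] [NormedSpace ℝ E] [FiniteDimensional ℝ E]

/-- A sequence such that `x n - N x n'` is bounded, with `|n'| ≤ |n|`, is bounded if `N` has a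
contracting power. -/
theorem bounded_of_contracting (N : Module.End ℝ E) {k : ℕ}
    (hk : ∀ x : E, ‖(N ^ k) x‖ ≤ 1 / 2 * ‖x‖) (x : ℤ → E) {C : ℝ}
    (hx : ∀ n : ℤ, ∃ n' : ℤ, |n'| ≤ |n| ∧ ‖x n - N (x n')‖ ≤ C) : ∃ R, ∀ n, ‖x n‖ ≤ R := by
  have hiter : ∀ k : ℕ, ∃ D, ∀ n : ℤ, ∃ n' : ℤ, |n'| ≤ |n| ∧ ‖x n - (N ^ k) (x n')‖ ≤ D := by
    intro k
    induction k with
    | zero => exact ⟨0, fun n => ⟨n, le_rfl, by simp⟩⟩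
    | succ k ih =>
      obtain ⟨D, hD⟩ := ih
      let T := LinearMap.toContinuousLinearMap (N ^ k)
      refine ⟨D + ‖T‖ * C, fun n => ?_⟩
      obtain ⟨n', h1, h2⟩ := hD n
      obtain ⟨n'', h3, h4⟩ := hx n'
      refine ⟨n'', h3.trans h1, ?_⟩
      have h5 : x n - (N ^ (k + 1)) (x n'') =
          (x n - (N ^ k) (x n')) + T (x n' - N (x n'')) := by
        rw [pow_succ, Module.End.mul_apply]
        change _ = (x n - (N ^ k) (x n')) + (N ^ k) (x n' - N (x n''))
        rw [map_sub]; abel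
      rw [h5]
      exact (norm_add_le _ _).trans (add_le_add h2 ((T.le_opNorm _).trans
        (mul_le_mul_of_nonneg_left h4 (norm_nonneg _))))
  obtain ⟨D, hD⟩ := hiter k
  refine ⟨2 * D, fun n => ?_⟩
  -- As `|m'| ≤ |m|`, the index `m'` stays in the interval where `‖x m‖` is maximal, so `‖x m‖ ≤ D +
  -- ‖x m‖ / 2`.
  obtain ⟨m, hm, hmax⟩ := Finset.exists_max_image (Finset.Icc (-|n|) |n|) (fun i => ‖x i‖)
    ⟨n, Finset.mem_Icc.2 (abs_le.1 le_rfl)⟩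
  obtain ⟨m', h1, h2⟩ := hD m
  have h3 := hmax m' (Finset.mem_Icc.2 (abs_le.1 (h1.trans (abs_le.2 (Finset.mem_Icc.1 hm)))))
  have h4 := hmax n (Finset.mem_Icc.2 (abs_le.1 le_rfl))
  have h5 := norm_le_norm_add_norm_sub ((N ^ k) (x m')) (x m)
  rw [norm_sub_rev] at h5
  linarith [hk (x m')]

variable {A : Type*} [Fintype A] [DecidableEq A] {σ : Substitution A} {u : ℤ → A}

/-- If `n` lies in the block `σ(u_m)`, then `V ab(u_{[0,n)})` is `N V ab(u_{[0,m)})` plus the image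
of a prefix of `σ(u_m)`, from a finite set; and `|m| ≤ |n|` since blocks are non-empty. -/
theorem exists_bound_abPrefix (hfix : σ.onBiinfinite u = u) {V : (A → ℝ) →ₗ[ℝ] E}
    {N : Module.End ℝ E} (hN : N ∘ₗ V = V ∘ₗ σ.incidenceEnd) {k : ℕ}
    (hk : ∀ x : E, ‖(N ^ k) x‖ ≤ 1 / 2 * ‖x‖) : ∃ R, ∀ n, ‖V (abPrefix u n)‖ ≤ R := by
  refine bounded_of_contracting N hk (fun n => V (abPrefix u n))
    (C := ∑ a, ∑ j ∈ Finset.range (σ.image a).length, ‖V (ab ((σ.image a).take j))‖) fun n => ?_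
  obtain ⟨m, j, hj, rfl⟩ := σ.exists_pos_add u n
  refine ⟨m, ?_, ?_⟩
  · rcases le_or_gt 0 m with hm | hm
    · have := σ.le_pos u hm
      rw [abs_of_nonneg hm, abs_of_nonneg (by omega)]
      omega
    · have h1 := σ.pos_le u (Int.add_one_le_iff.2 hm)
      rw [σ.pos_add_one] at h1
      rw [abs_of_neg hm, abs_of_neg (by omega)]
      omega
  · have h1 := σ.abPrefix_pos u m
    have h2 := LinearMap.congr_fun hN (abPrefix u m)
    have h3 := σ.factor_onBiinfinite_image u m
    rw [hfix] at h1 h3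
    simp only [LinearMap.comp_apply] at h2
    rw [h2, ← h1, abPrefix_add_natCast, map_add, add_sub_cancel_left,
      ← factor_take u (σ.pos u m) hj.le, h3]
    refine le_trans ?_ (Finset.single_le_sum (f := fun a =>
      ∑ j ∈ Finset.range (σ.image a).length, ‖V (ab ((σ.image a).take j))‖)
      (fun a _ => Finset.sum_nonneg fun _ _ => norm_nonneg _) (Finset.mem_univ (u m)))
    exact Finset.single_le_sum (f := fun j => ‖V (ab ((σ.image (u m)).take j))‖)
      (fun _ _ => norm_nonneg _) (Finset.mem_range.2 hj)

end Bounded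

/-! ### Extension of a bounded cocycle over a minimal system. -/

section Graph

variable {A : Type*} [DecidableEq A] [TopologicalSpace A]
  {E : Type*} [NormedAddCommGroup E] [NormedSpace ℝ E]

/-- The closure of the graph of the map `S^n u ↦ V ab(u_{[0,n)})`. -/
def graphClosure (V : (A → ℝ) →ₗ[ℝ] E) (u : ℤ → A) : Set ((ℤ → A) × E) :=
  closure (Set.range fun n : ℤ => (shiftPow n u, V (abPrefix u n)))

variable {V : (A → ℝ) →ₗ[ℝ] E} {u : ℤ → A}

theorem isClosed_graphClosure : IsClosed (graphClosure V u) := isClosed_closure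

theorem mem_graphClosure_orbit (n : ℤ) : (shiftPow n u, V (abPrefix u n)) ∈ graphClosure V u :=
  subset_closure ⟨n, rfl⟩

theorem norm_le_of_mem_graphClosure {R : ℝ} (hR : ∀ n, ‖V (abPrefix u n)‖ ≤ R)
    {q : (ℤ → A) × E} (hq : q ∈ graphClosure V u) : ‖q.2‖ ≤ R := by
  have : graphClosure V u ⊆ {q | ‖q.2‖ ≤ R} := closure_minimal
    (by rintro _ ⟨n, rfl⟩; exact hR n) (isClosed_le (by fun_prop) continuous_const)
  exact this hq

theorem continuous_abPrefix [DiscreteTopology A] (n : ℤ) :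
    Continuous fun v : ℤ → A => V (abPrefix v n) := by
  refine continuous_iff_continuousAt.2 fun u => tendsto_nhds_of_eventually_eq ?_
  rcases n with n | n
  · filter_upwards [eventually_factor_eq u 0 n] with v hv
    simp only [abPrefix, hv]
  · filter_upwards [eventually_factor_eq u (-((n : ℤ) + 1)) (n + 1)] with v hv
    simp only [abPrefix, hv]

/-- By the cocycle relation, this skew product preserves the graph over the orbit; it is continuous,
so it preserves the closure. -/
theorem graphClosure_shift [DiscreteTopology A] {q : (ℤ → A) × E} (hq : q ∈ graphClosure V u)
    (n : ℤ) : (shiftPow n q.1, q.2 + V (abPrefix q.1 n)) ∈ graphClosure V u := by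
  have hc : Continuous fun q : (ℤ → A) × E => (shiftPow n q.1, q.2 + V (abPrefix q.1 n)) :=
    ((continuous_shiftPow n).comp continuous_fst).prodMk
      (continuous_snd.add ((continuous_abPrefix n).comp continuous_fst))
  have := map_mem_closure hc hq (t := Set.range fun n : ℤ => (shiftPow n u, V (abPrefix u n))) (by
    rintro _ ⟨m, rfl⟩
    refine ⟨n + m, ?_⟩
    simp only [shiftPow_add, abPrefix_shift, map_sub]
    rw [add_sub_cancel])
  exact this

/-- The fiber of the closure of the graph over the base point is trivial. -/
theorem eq_zero_of_mem_graphClosure [DiscreteTopology A] {R : ℝ}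
    (hR : ∀ n, ‖V (abPrefix u n)‖ ≤ R) {c : E} (hc : (u, c) ∈ graphClosure V u) : c = 0 := by
  -- Shifting `(u, c)` along the orbit shows that the closure is stable by translation by `c`. It
  -- then contains every `(u, k c)`, which boundedness forbids unless `c = 0`.
  have h1 : ∀ q ∈ graphClosure V u, (q.1, q.2 + c) ∈ graphClosure V u := by
    intro q hq
    have hcont : Continuous fun q : (ℤ → A) × E => (q.1, q.2 + c) := by fun_prop
    have := map_mem_closure hcont hq (t := graphClosure V u) (by
      rintro _ ⟨n, rfl⟩
      have := graphClosure_shift hc n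
      simpa only [add_comm] using this)
    rwa [isClosed_graphClosure.closure_eq] at this
  have h2 : ∀ k : ℕ, (u, (k : ℝ) • c) ∈ graphClosure V u := by
    intro k
    induction k with
    | zero =>
      have := mem_graphClosure_orbit (V := V) (u := u) 0
      simpa [shiftPow_zero, abPrefix_zero] using this
    | succ k ih =>
      have := h1 _ ih
      simpa [add_smul] using this
  by_contra hne
  obtain ⟨k, hk⟩ := exists_nat_gt (R / ‖c‖)
  rw [div_lt_iff₀ (norm_pos_iff.2 hne)] at hk
  have := norm_le_of_mem_graphClosure hR (h2 k)
  simp only [norm_smul, Real.norm_natCast] at this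
  linarith

variable [FiniteDimensional ℝ E] [Finite A]

theorem isCompact_graphClosure {R : ℝ} (hR : ∀ n, ‖V (abPrefix u n)‖ ≤ R) :
    IsCompact (graphClosure V u) := by
  have := FiniteDimensional.proper_real E
  refine (isCompact_univ.prod (isCompact_closedBall (0 : E) R)).of_isClosed_subset isClosed_closure
    fun q hq => ⟨trivial, ?_⟩
  rw [mem_closedBall_zero_iff]
  exact norm_le_of_mem_graphClosure hR hq

variable [DiscreteTopology A]

theorem exists_mem_graphClosure {R : ℝ} (hR : ∀ n, ‖V (abPrefix u n)‖ ≤ R) {v : ℤ → A}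
    (hv : v ∈ closure (Set.range fun n : ℤ => shiftPow n u)) :
    ∃ e, (v, e) ∈ graphClosure V u := by
  have h1 : IsClosed (Prod.fst '' graphClosure V u) :=
    ((isCompact_graphClosure hR).image continuous_fst).isClosed
  obtain ⟨⟨w, e⟩, he, rfl⟩ := closure_minimal (s := Set.range fun n : ℤ => shiftPow n u)
    (by rintro _ ⟨n, rfl⟩; exact ⟨_, mem_graphClosure_orbit n, rfl⟩) h1 hv
  exact ⟨e, he⟩

/-- The fibers of the closure of the graph have at most one element, by minimality. -/
theorem eq_of_mem_graphClosure {R : ℝ} (hR : ∀ n, ‖V (abPrefix u n)‖ ≤ R) {v : ℤ → A}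
    (hv : u ∈ closure (Set.range fun n : ℤ => shiftPow n v)) {e e' : E}
    (he : (v, e) ∈ graphClosure V u) (he' : (v, e') ∈ graphClosure V u) : e = e' := by
  -- The projection of `H` is compact and contains the orbit of `v`, because both points move by the
  -- same cocycle and keep the difference `e' - e`. So it contains `u`, over which the fiber is
  -- trivial.
  set H : Set ((ℤ → A) × E) :=
    graphClosure V u ∩ (fun q => (q.1, q.2 + (e' - e))) ⁻¹' graphClosure V u
  have hH : IsCompact H := (isCompact_graphClosure hR).inter_right
    (isClosed_closure.preimage (by fun_prop))
  obtain ⟨⟨w, f⟩, hf, rfl⟩ := closure_minimal (s := Set.range fun n : ℤ => shiftPow n v)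
    (t := Prod.fst '' H) (by
      rintro _ ⟨n, rfl⟩
      refine ⟨_, ⟨graphClosure_shift he n, ?_⟩, rfl⟩
      have := graphClosure_shift he' n
      simp only [Set.mem_preimage]
      convert this using 2
      abel) (hH.image continuous_fst).isClosed hv
  have h1 := eq_zero_of_mem_graphClosure hR hf.1
  have h2 := eq_zero_of_mem_graphClosure hR hf.2
  rw [h1, zero_add, sub_eq_zero] at h2
  exact h2.symm

/-- By compactness only cluster values matter, and these lie in the one-point fiber over `v`. This
serves both for the limit defining `rauzyMap` and for its continuity. -/
theorem tendsto_of_mem_graphClosure {R : ℝ} (hR : ∀ n, ‖V (abPrefix u n)‖ ≤ R) {v : ℤ → A}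
    (hv : u ∈ closure (Set.range fun n : ℤ => shiftPow n v)) {e : E}
    (he : (v, e) ∈ graphClosure V u) {X : Type*} {l : Filter X} {g : X → ℤ → A} {f : X → E}
    (hg : Tendsto g l (𝓝 v)) (hgf : ∀ᶠ x in l, (g x, f x) ∈ graphClosure V u) :
    Tendsto f l (𝓝 e) := by
  have := FiniteDimensional.proper_real E
  refine (isCompact_closedBall (0 : E) R).tendsto_nhds_of_unique_mapClusterPt ?_ ?_
  · filter_upwards [hgf] with x hx
    rw [mem_closedBall_zero_iff]
    exact norm_le_of_mem_graphClosure hR hx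
  · intro y _ hy
    refine eq_of_mem_graphClosure hR hv ?_ he
    have hcl : (v, y) ∈ closure (graphClosure V u) := by
      rw [mem_closure_iff_nhds]
      intro t ht
      obtain ⟨s, hs, w, hw, hsw⟩ := mem_nhds_prod_iff.1 ht
      obtain ⟨x, hx1, hx2, hx3⟩ := ((hy.frequently hw).and_eventually
        ((hg.eventually hs).and hgf)).exists
      exact ⟨(g x, f x), hsw ⟨hx2, hx1⟩, hx3⟩
    rwa [isClosed_graphClosure.closure_eq] at hcl

end Graph

/-! ### Counting the transitions of the prefix automaton. -/

section Transitions

variable {A : Type*} [DecidableEq A] {σ : Substitution A}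

/-- The transitions of the prefix automaton from `b` to `a`. -/
noncomputable def Substitution.transitions (σ : Substitution A) (b a : A) : Finset (A → ℝ) := by
  classical
  exact ((Finset.range (σ.image b).length).filter fun j => (σ.image b)[j]? = some a).image
    fun j => ab ((σ.image b).take j)

theorem Substitution.mem_transitions {b a : A} {t : A → ℝ} :
    t ∈ σ.transitions b a ↔ σ.Transition b t a := by
  simp only [Substitution.transitions, Finset.mem_image, Finset.mem_filter, Finset.mem_range,
    Substitution.Transition]
  constructor
  · rintro ⟨j, ⟨hj, hja⟩, rfl⟩
    refine ⟨_, (σ.image b).drop (j + 1), ?_, rfl⟩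
    obtain ⟨h4, h5⟩ := List.getElem?_eq_some_iff.1 hja
    rw [← h5, List.getElem_cons_drop, List.take_append_drop]
  · rintro ⟨p, s, hps, rfl⟩
    refine ⟨p.length, ⟨by rw [hps]; simp, by rw [hps]; simp⟩, by rw [hps, List.take_left]⟩

/-- Occurrences are counted by position, and abelianizing the prefixes cannot increase the count. An
upper bound is all that the measure estimates require. -/
theorem Substitution.card_transitions_le (b a : A) :
    (σ.transitions b a).card ≤ σ.incidence a b := by
  classical
  rw [Substitution.transitions]
  refine Finset.card_image_le.trans (le_of_eq ?_)
  simp only [Substitution.incidence, Matrix.of_apply]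
  generalize σ.image b = l
  induction l using List.reverseRecOn with
  | nil => simp
  | append_singleton l c ih =>
    rw [List.count_append, ← ih, List.length_append, List.length_singleton, Finset.range_add_one,
      Finset.filter_insert]
    have h1 : (Finset.range l.length).filter (fun j => (l ++ [c])[j]? = some a) =
        (Finset.range l.length).filter (fun j => l[j]? = some a) := by
      refine Finset.filter_congr fun j hj => ?_
      rw [List.getElem?_append_left (Finset.mem_range.1 hj)]
    rw [h1]
    by_cases h : c = a
    · subst h
      simp
    · simp [h]

end Transitions

/-! ### The Rauzy map and the decomposition of the pieces. -/

section RauzyMap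

variable {A : Type*} [Fintype A] [DecidableEq A] [TopologicalSpace A] [DiscreteTopology A] {d : ℕ}
  {V : (A → ℝ) →ₗ[ℝ] EuclideanSpace ℝ (Fin d)} {u : ℤ → A} {σ : Substitution A} {R : ℝ}

theorem rauzyMap_eq (hR : ∀ n, ‖V (abPrefix u n)‖ ≤ R)
    (hmin : ∀ v ∈ σ.subshift, u ∈ closure (Set.range fun n : ℤ => shiftPow n v))
    (hfix : σ.onBiinfinite u = u) {v : ℤ → A} (hv : v ∈ σ.subshift)
    {e : EuclideanSpace ℝ (Fin d)} (he : (v, e) ∈ graphClosure V u) : rauzyMap V u v = e := by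
  have hne : (comap (fun n : ℤ => shiftPow n u) (𝓝 v)).NeBot := by
    rw [comap_neBot_iff]
    intro t ht
    obtain ⟨_, h1, n, rfl⟩ :=
      mem_closure_iff_nhds.1 (subshift_subset_closure_orbit hfix hv) t ht
    exact ⟨n, h1⟩
  exact (tendsto_of_mem_graphClosure hR (hmin v hv) he tendsto_comap
    (Eventually.of_forall fun n => mem_graphClosure_orbit n)).limUnder_eq

theorem mem_graphClosure_rauzyMap (hR : ∀ n, ‖V (abPrefix u n)‖ ≤ R)
    (hmin : ∀ v ∈ σ.subshift, u ∈ closure (Set.range fun n : ℤ => shiftPow n v))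
    (hfix : σ.onBiinfinite u = u) {v : ℤ → A} (hv : v ∈ σ.subshift) :
    (v, rauzyMap V u v) ∈ graphClosure V u := by
  obtain ⟨e, he⟩ := exists_mem_graphClosure hR (subshift_subset_closure_orbit hfix hv)
  rwa [rauzyMap_eq hR hmin hfix hv he]

theorem continuousOn_rauzyMap (hR : ∀ n, ‖V (abPrefix u n)‖ ≤ R)
    (hmin : ∀ v ∈ σ.subshift, u ∈ closure (Set.range fun n : ℤ => shiftPow n v))
    (hfix : σ.onBiinfinite u = u) : ContinuousOn (rauzyMap V u) σ.subshift := by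
  intro v hv
  refine tendsto_of_mem_graphClosure hR (hmin v hv) (mem_graphClosure_rauzyMap hR hmin hfix hv)
    (g := id) (tendsto_id.mono_left nhdsWithin_le_nhds) ?_
  filter_upwards [self_mem_nhdsWithin] with w hw
  exact mem_graphClosure_rauzyMap hR hmin hfix hw

theorem rauzyMap_orbit (hR : ∀ n, ‖V (abPrefix u n)‖ ≤ R)
    (hmin : ∀ v ∈ σ.subshift, u ∈ closure (Set.range fun n : ℤ => shiftPow n v))
    (hfix : σ.onBiinfinite u = u) (hu : u ∈ σ.subshift) (n : ℤ) :
    rauzyMap V u (shiftPow n u) = V (abPrefix u n) :=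
  rauzyMap_eq hR hmin hfix (σ.shiftPow_mem_subshift hu n) (mem_graphClosure_orbit n)

theorem rauzyMap_shift (hR : ∀ n, ‖V (abPrefix u n)‖ ≤ R)
    (hmin : ∀ v ∈ σ.subshift, u ∈ closure (Set.range fun n : ℤ => shiftPow n v))
    (hfix : σ.onBiinfinite u = u) {v : ℤ → A} (hv : v ∈ σ.subshift) (n : ℤ) :
    rauzyMap V u (shiftPow n v) = rauzyMap V u v + V (abPrefix v n) :=
  rauzyMap_eq hR hmin hfix (σ.shiftPow_mem_subshift hv n)
    (graphClosure_shift (mem_graphClosure_rauzyMap hR hmin hfix hv) n)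

/-- The Rauzy map conjugates the substitution to `N`. -/
theorem rauzyMap_onBiinfinite (hR : ∀ n, ‖V (abPrefix u n)‖ ≤ R)
    (hmin : ∀ v ∈ σ.subshift, u ∈ closure (Set.range fun n : ℤ => shiftPow n v))
    (hfix : σ.onBiinfinite u = u) {N : Module.End ℝ (EuclideanSpace ℝ (Fin d))}
    (hN : N ∘ₗ V = V ∘ₗ σ.incidenceEnd) {v : ℤ → A} (hv : v ∈ σ.subshift) :
    rauzyMap V u (σ.onBiinfinite v) = N (rauzyMap V u v) := by
  refine rauzyMap_eq hR hmin hfix (σ.mapsTo_subshift hv) ?_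
  have hc : Continuous fun q : (ℤ → A) × EuclideanSpace ℝ (Fin d) =>
      (σ.onBiinfinite q.1, N q.2) :=
    (σ.continuous_onBiinfinite.comp continuous_fst).prodMk
      (N.continuous_of_finiteDimensional.comp continuous_snd)
  have := map_mem_closure hc (mem_graphClosure_rauzyMap hR hmin hfix hv)
    (t := Set.range fun n : ℤ => (shiftPow n u, V (abPrefix u n))) (by
    rintro _ ⟨n, rfl⟩
    refine ⟨σ.pos u n, ?_⟩
    have h1 := σ.abPrefix_pos u n
    rw [hfix] at h1
    simp only [σ.onBiinfinite_shiftPow, hfix, h1]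
    rw [← LinearMap.comp_apply, ← hN, LinearMap.comp_apply])
  exact this

theorem isCompact_rauzyPiece (hR : ∀ n, ‖V (abPrefix u n)‖ ≤ R)
    (hmin : ∀ v ∈ σ.subshift, u ∈ closure (Set.range fun n : ℤ => shiftPow n v))
    (hfix : σ.onBiinfinite u = u) (a : A) : IsCompact (rauzyPiece σ V u a) := by
  have h1 : IsCompact {v ∈ σ.subshift | v 0 = a} :=
    (Substitution.isCompact_subshift (σ := σ)).inter_right
      ((isClosed_discrete ({a} : Set A)).preimage
        (continuous_apply (0 : ℤ) : Continuous fun w : ℤ → A => w 0))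
  exact h1.image_of_continuousOn
    ((continuousOn_rauzyMap hR hmin hfix).mono fun v hv => hv.1)

/-- The decomposition of the pieces by the prefix automaton. -/
theorem rauzyPiece_eq (hR : ∀ n, ‖V (abPrefix u n)‖ ≤ R)
    (hmin : ∀ v ∈ σ.subshift, u ∈ closure (Set.range fun n : ℤ => shiftPow n v))
    (hfix : σ.onBiinfinite u = u) (hu : u ∈ σ.subshift)
    {N : Module.End ℝ (EuclideanSpace ℝ (Fin d))}
    (hN : N ∘ₗ V = V ∘ₗ σ.incidenceEnd) (a : A) :
    rauzyPiece σ V u a = ⋃ x ∈ {x : A × (A → ℝ) | σ.Transition x.1 x.2 a},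
      (fun y => N y + V x.2) '' rauzyPiece σ V u x.1 := by
  -- One computation serves both inclusions: `φ(S^j σ(w)) = N φ(w) + V ab(p)`, with `p` the prefix
  -- of length `j` of `σ(w_0)`.
  have key : ∀ w ∈ σ.subshift, ∀ j : ℕ, j < (σ.image (w 0)).length →
      shiftPow j (σ.onBiinfinite w) ∈ σ.subshift ∧
      (σ.image (w 0))[j]? = some (shiftPow j (σ.onBiinfinite w) 0) ∧
      rauzyMap V u (shiftPow j (σ.onBiinfinite w)) =
        N (rauzyMap V u w) + V (ab ((σ.image (w 0)).take j)) := by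
    intro w hw j hj
    have hσw := σ.mapsTo_subshift hw
    refine ⟨σ.shiftPow_mem_subshift hσw j, ?_, ?_⟩
    · rw [σ.getElem?_image w 0 j hj, σ.pos_zero]; rfl
    · have h1 := σ.factor_onBiinfinite_image w 0
      have h2 := abPrefix_add_natCast (σ.onBiinfinite w) 0 j
      rw [zero_add, abPrefix_zero, zero_add] at h2
      rw [σ.pos_zero] at h1
      rw [rauzyMap_shift hR hmin hfix hσw, rauzyMap_onBiinfinite hR hmin hfix hN hw, h2,
        ← factor_take _ _ hj.le, h1]
  apply Set.Subset.antisymm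
  · rintro _ ⟨v, ⟨hv, hva⟩, rfl⟩
    obtain ⟨w, hw, j, hj, rfl⟩ := exists_desubstitution hu hfix hv
    obtain ⟨-, h2, h3⟩ := key w hw j hj
    refine Set.mem_iUnion₂.2 ⟨(w 0, ab ((σ.image (w 0)).take j)),
      ⟨(σ.image (w 0)).take j, (σ.image (w 0)).drop (j + 1), ?_, rfl⟩,
      rauzyMap V u w, ⟨w, ⟨hw, rfl⟩, rfl⟩, h3.symm⟩
    rw [hva] at h2
    obtain ⟨h4, h5⟩ := List.getElem?_eq_some_iff.1 h2
    rw [← h5, List.getElem_cons_drop, List.take_append_drop]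
  · refine Set.iUnion₂_subset ?_
    rintro ⟨b, t⟩ ⟨p, s, hps, rfl⟩
    rintro _ ⟨_, ⟨w, ⟨hw, rfl⟩, rfl⟩, rfl⟩
    simp only at hps ⊢
    obtain ⟨h1, h2, h3⟩ := key w hw p.length (by rw [hps]; simp)
    refine ⟨_, ⟨h1, ?_⟩, ?_⟩
    · rw [hps] at h2
      simpa using h2.symm
    · rw [h3, hps, List.take_left]

end RauzyMap

/-! ### Graph-directed systems: interiors and boundaries. -/

section GraphDirected

variable {A : Type*} {E : Type*} [NormedAddCommGroup E] [NormedSpace ℝ E]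

/-- The sets `R a` are the solution of the graph-directed system of affine maps `y ↦ L y + c`, for
`c ∈ J b a`, whose incidence matrix is bounded by `M`, with the same support. -/
structure IsGraphDirected (L : Module.End ℝ E) (M : Matrix A A ℕ) (J : A → A → Finset E)
    (R : A → Set E) : Prop where
  card_le : ∀ b a, (J b a).card ≤ M a b
  nonempty : ∀ b a, 0 < M a b → (J b a).Nonempty
  eq_iUnion : ∀ a, R a = ⋃ b, ⋃ c ∈ J b a, (fun y => L y + c) '' R b

variable {N L : Module.End ℝ E} {M : Matrix A A ℕ} {J : A → A → Finset E} {R : A → Set E}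

theorem IsGraphDirected.mem_iff {J : A → A → Finset E} (h : IsGraphDirected L M J R) {a : A}
    {x : E} : x ∈ R a ↔ ∃ b, ∃ c ∈ J b a, ∃ y ∈ R b, L y + c = x := by
  rw [h.eq_iUnion a]
  simp

theorem measure_ne_top_of_subset_isCompact {X : Type*} [TopologicalSpace X] [MeasurableSpace X]
    (μ : Measure X) [IsFiniteMeasureOnCompacts μ] {K s : Set X} (hK : IsCompact K) (hs : s ⊆ K) :
    μ s ≠ ⊤ := ((measure_mono hs).trans_lt hK.measure_lt_top).ne

theorem exists_norm_le_of_isCompact {E : Type*} [NormedAddCommGroup E]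
    {R : A → Set E} [Finite A] (hR : ∀ a, IsCompact (R a)) :
    ∃ ρ : ℝ, 0 < ρ ∧ ∀ a, ∀ x ∈ R a, ‖x‖ ≤ ρ := by
  obtain ⟨ρ, hρ⟩ := (isCompact_iUnion hR).isBounded.exists_norm_le
  refine ⟨max ρ 1, by positivity, fun a x hx => ?_⟩
  exact (hρ x (Set.mem_iUnion.2 ⟨a, hx⟩)).trans (le_max_left _ _)

theorem isOpenMap_affine [FiniteDimensional ℝ E] (hL : IsUnit L) (c : E) :
    IsOpenMap fun y => L y + c := by
  have h1 : Function.Surjective L := ((Module.End.isUnit_iff L).1 hL).2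
  have h2 : IsOpenMap L := LinearMap.isOpenMap_of_finiteDimensional L h1
  exact (Homeomorph.addRight c).isOpenMap.comp h2

theorem IsGraphDirected.interior_subset [FiniteDimensional ℝ E] (h : IsGraphDirected L M J R)
    (hL : IsUnit L) {a b : A} {c : E} (hc : c ∈ J b a) {y : E} (hy : y ∈ interior (R b)) :
    L y + c ∈ interior (R a) := by
  have h1 : (fun y => L y + c) '' interior (R b) ⊆ interior (R a) := by
    refine interior_maximal ?_ (isOpenMap_affine hL c _ isOpen_interior)
    rintro _ ⟨z, hz, rfl⟩
    exact h.mem_iff.2 ⟨b, c, hc, z, _root_.interior_subset hz, rfl⟩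
  exact h1 ⟨y, hy, rfl⟩

/-- A point of the boundary of `R a` is in the image of a point of the boundary of some `R b`, and
in no piece that is contained in the interior. -/
theorem IsGraphDirected.frontier_subset [FiniteDimensional ℝ E] (h : IsGraphDirected L M J R)
    (hL : IsUnit L) (hR : ∀ a, IsCompact (R a)) {a : A} {x : E} (hx : x ∈ frontier (R a)) :
    ∃ b, ∃ c ∈ J b a, x ∈ (fun y => L y + c) '' frontier (R b) ∧
      ¬ (fun y => L y + c) '' R b ⊆ interior (R a) := by
  rw [(hR a).isClosed.frontier_eq] at hx
  obtain ⟨b, c, hc, y, hy, hyx⟩ := h.mem_iff.1 hx.1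
  refine ⟨b, c, hc, ⟨y, ?_, hyx⟩, fun hsub => hx.2 (hsub ⟨y, hy, hyx⟩)⟩
  rw [(hR b).isClosed.frontier_eq]
  exact ⟨hy, fun hy' => hx.2 (hyx ▸ h.interior_subset hL hc hy')⟩

variable [Fintype A] [DecidableEq A]

/-- Composed maps may coincide, which is why the structure only bounds their number by the matrix
and records non-emptiness separately. -/
theorem IsGraphDirected.pow (h : IsGraphDirected N M J R) (k : ℕ) :
    ∃ Jk : A → A → Finset E, IsGraphDirected (N ^ k) (M ^ k) Jk R := by
  classical
  induction k with
  | zero =>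
    refine ⟨fun b a => if a = b then {0} else ∅, ⟨fun b a => ?_, fun b a => ?_, fun a => ?_⟩⟩
    · simp only [pow_zero, Matrix.one_apply]
      split_ifs <;> simp
    · simp only [pow_zero, Matrix.one_apply]
      split_ifs <;> simp
    · ext x
      simp only [Set.mem_iUnion, Set.mem_image, exists_prop, pow_zero, Module.End.one_apply]
      constructor
      · exact fun hx => ⟨a, 0, by simp, x, hx, add_zero x⟩
      · rintro ⟨b, c, hc, y, hy, rfl⟩
        split_ifs at hc with hab
        · rw [Finset.mem_singleton.1 hc, add_zero, hab]; exact hy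
        · simp at hc
  | succ k ih =>
    obtain ⟨Jk, hk⟩ := ih
    refine ⟨fun b a => Finset.univ.biUnion fun e =>
      Finset.image₂ (fun t s => (N ^ k) s + t) (Jk e a) (J b e),
      ⟨fun b a => ?_, fun b a hpos => ?_, fun a => ?_⟩⟩
    · rw [pow_succ, Matrix.mul_apply]
      refine Finset.card_biUnion_le.trans (Finset.sum_le_sum fun e _ => ?_)
      exact (Finset.card_image₂_le _ _ _).trans (Nat.mul_le_mul (hk.card_le e a) (h.card_le b e))
    · rw [pow_succ, Matrix.mul_apply] at hpos
      obtain ⟨e, -, he⟩ := Finset.exists_ne_zero_of_sum_ne_zero hpos.ne'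
      obtain ⟨h1, h2⟩ := mul_ne_zero_iff.1 he
      exact Finset.Nonempty.mono (Finset.subset_biUnion_of_mem (fun e =>
        Finset.image₂ (fun t s => (N ^ k) s + t) (Jk e a) (J b e)) (Finset.mem_univ e))
        ((hk.nonempty e a (Nat.pos_of_ne_zero h1)).image₂
          (h.nonempty b e (Nat.pos_of_ne_zero h2)))
    · ext x
      rw [hk.mem_iff]
      simp only [Set.mem_iUnion, Set.mem_image, Finset.mem_biUnion, Finset.mem_univ, true_and,
        Finset.mem_image₂, exists_prop]
      constructor
      · rintro ⟨e, t, ht, z, hz, rfl⟩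
        obtain ⟨b, s, hs, y, hy, rfl⟩ := h.mem_iff.1 hz
        refine ⟨b, _, ⟨e, t, ht, s, hs, rfl⟩, y, hy, ?_⟩
        rw [pow_succ, Module.End.mul_apply, map_add, add_assoc]
      · rintro ⟨b, _, ⟨e, t, ht, s, hs, rfl⟩, y, hy, rfl⟩
        refine ⟨e, t, ht, N y + s, h.mem_iff.2 ⟨b, s, hs, y, hy, rfl⟩, ?_⟩
        rw [pow_succ, Module.End.mul_apply, map_add, add_assoc]

variable [FiniteDimensional ℝ E]

/-- If one of the sets has non-empty interior then all do, by primitivity. -/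
theorem IsGraphDirected.interior_nonempty (h : IsGraphDirected N M J R) (hN : IsUnit N) {k : ℕ}
    (hk : ∀ a b, 0 < (M ^ k) a b) {b : A} (hb : (interior (R b)).Nonempty) (a : A) :
    (interior (R a)).Nonempty := by
  obtain ⟨Jk, hJk⟩ := h.pow k
  obtain ⟨c, hc⟩ := hJk.nonempty b a (hk a b)
  obtain ⟨y, hy⟩ := hb
  exact ⟨_, hJk.interior_subset (hN.pow k) hc hy⟩

/-- A point of `R a` lies in a copy of some `R b` of diameter at most `ε / 2`, and the copy of an
interior point of `R b` is interior to `R a`. -/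
theorem IsGraphDirected.eq_closure_interior (h : IsGraphDirected N M J R) (hN : IsUnit N)
    (hcontr : ∀ ε : ℝ, 0 < ε → ∃ k : ℕ, ∀ x : E, ‖(N ^ k) x‖ ≤ ε * ‖x‖)
    (hR : ∀ a, IsCompact (R a)) (hint : ∀ a, (interior (R a)).Nonempty) (a : A) :
    R a = closure (interior (R a)) := by
  refine Set.Subset.antisymm (fun x hx => ?_) (closure_minimal _root_.interior_subset
    (hR a).isClosed)
  obtain ⟨ρ, hρ0, hρ⟩ := exists_norm_le_of_isCompact hR
  rw [Metric.mem_closure_iff]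
  intro ε hε
  obtain ⟨k, hk⟩ := hcontr (ε / (4 * ρ)) (by positivity)
  obtain ⟨Jk, hJk⟩ := h.pow k
  obtain ⟨b, c, hc, y, hy, rfl⟩ := hJk.mem_iff.1 hx
  obtain ⟨z, hz⟩ := hint b
  refine ⟨_, hJk.interior_subset (hN.pow k) hc hz, ?_⟩
  rw [dist_add_right, dist_eq_norm, ← map_sub]
  have h1 : ‖y - z‖ ≤ 2 * ρ := by
    have := norm_sub_le y z
    linarith [hρ b y hy, hρ b z (_root_.interior_subset hz)]
  calc ‖(N ^ k) (y - z)‖ ≤ ε / (4 * ρ) * ‖y - z‖ := hk _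
    _ ≤ ε / (4 * ρ) * (2 * ρ) := mul_le_mul_of_nonneg_left h1 (by positivity)
    _ = ε / 2 := by field_simp; norm_num
    _ < ε := by linarith

variable [MeasurableSpace E] [BorelSpace E] (μ : Measure E) [μ.IsAddHaarMeasure]

open Pointwise in
theorem measureReal_affine_image (L : Module.End ℝ E) (c : E) (s : Set E) :
    μ.real ((fun y => L y + c) '' s) = |LinearMap.det L| * μ.real s := by
  have h1 : (fun y => L y + c) '' s = c +ᵥ (L '' s) := by
    rw [← Set.image_vadd, Set.image_image]
    simp only [vadd_eq_add, add_comm]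
  rw [measureReal_def, h1, measure_vadd, Measure.addHaar_image_linearMap, ENNReal.toReal_mul,
    ENNReal.toReal_ofReal (abs_nonneg _), measureReal_def]

/-- The measure of the boundaries is subinvariant. The letter `b₀` is that of a piece contained in
the interior, if there is one. -/
theorem IsGraphDirected.measure_frontier_le (h : IsGraphDirected L M J R) (hL : IsUnit L)
    (hR : ∀ a, IsCompact (R a)) (a : A) :
    μ.real (frontier (R a)) ≤
      |LinearMap.det L| * ∑ b, (M a b : ℝ) * μ.real (frontier (R b)) ∧
    ∀ b₀, ∀ c₀ ∈ J b₀ a, (fun y => L y + c₀) '' R b₀ ⊆ interior (R a) →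
      μ.real (frontier (R a)) ≤ |LinearMap.det L| *
        ((∑ b, (M a b : ℝ) * μ.real (frontier (R b))) - μ.real (frontier (R b₀))) := by
  classical
  set κ := |LinearMap.det L|
  set m : A → ℝ := fun b => μ.real (frontier (R b))
  have hm : ∀ b, 0 ≤ m b := fun b => measureReal_nonneg
  have hfr : ∀ b, IsCompact (frontier (R b)) := fun b =>
    (hR b).of_isClosed_subset isClosed_frontier (hR b).isClosed.frontier_subset
  have hcard : ∀ b, ((J b a).card : ℝ) * (κ * m b) ≤ M a b * (κ * m b) := fun b =>
    mul_le_mul_of_nonneg_right (by exact_mod_cast h.card_le b a)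
      (mul_nonneg (abs_nonneg _) (hm b))
  -- A finite family of copies of boundaries that covers the boundary of `R a` bounds its measure.
  -- The first inequality takes all the copies, the second omits `(b₀, c₀)`.
  have hS : ∀ S : Finset (A × E),
      (∀ x ∈ frontier (R a), ∃ q ∈ S, x ∈ (fun y => L y + q.2) '' frontier (R q.1)) →
      m a ≤ ∑ q ∈ S, κ * m q.1 := by
    intro S hS
    have h1 : frontier (R a) ⊆ ⋃ q ∈ S, (fun y => L y + q.2) '' frontier (R q.1) := fun x hx => by
      obtain ⟨q, hq, hxq⟩ := hS x hx
      exact Set.mem_iUnion₂.2 ⟨q, hq, hxq⟩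
    have hcpt : IsCompact (⋃ q ∈ S, (fun y => L y + q.2) '' frontier (R q.1)) :=
      S.isCompact_biUnion fun q _ => (hfr q.1).image
        (L.continuous_of_finiteDimensional.add continuous_const)
    refine (measureReal_mono h1 hcpt.measure_lt_top.ne).trans
      ((measureReal_biUnion_finset_le _ _).trans (Finset.sum_le_sum fun q _ => ?_))
    rw [measureReal_affine_image]
  set S : Finset (A × E) := Finset.univ.biUnion fun b => (J b a).image fun c => (b, c)
  have hmemS : ∀ b c, (b, c) ∈ S ↔ c ∈ J b a := by
    intro b c
    simp [S]
  have hsum : ∑ q ∈ S, κ * m q.1 ≤ κ * ∑ b, (M a b : ℝ) * m b := by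
    rw [Finset.sum_biUnion, Finset.mul_sum]
    · refine Finset.sum_le_sum fun b _ => ?_
      rw [Finset.sum_image (fun _ _ _ _ h => (Prod.ext_iff.1 h).2)]
      simp only [Finset.sum_const, nsmul_eq_mul]
      linarith [hcard b]
    · intro b _ b' _ hne
      rw [Function.onFun, Finset.disjoint_left]
      rintro ⟨e, c⟩ h1 h2
      simp only [Finset.mem_image, Prod.mk.injEq] at h1 h2
      obtain ⟨_, _, rfl, _⟩ := h1
      obtain ⟨_, _, rfl, _⟩ := h2
      exact hne rfl
  refine ⟨(hS S fun x hx => ?_).trans hsum, fun b₀ c₀ hc₀ hsub => ?_⟩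
  · obtain ⟨b, c, hc, hx, -⟩ := h.frontier_subset hL hR hx
    exact ⟨(b, c), (hmemS b c).2 hc, hx⟩
  · have h1 := hS (S.erase (b₀, c₀)) fun x hx => by
      obtain ⟨b, c, hc, hx, hns⟩ := h.frontier_subset hL hR hx
      refine ⟨(b, c), Finset.mem_erase.2 ⟨?_, (hmemS b c).2 hc⟩, hx⟩
      rintro heq
      obtain ⟨rfl, rfl⟩ := Prod.mk.inj heq
      exact hns hsub
    have h2 := Finset.add_sum_erase S (fun q => κ * m q.1) ((hmemS b₀ c₀).2 hc₀)
    simp only at h2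
    rw [mul_sub]
    linarith

/-- The boundaries have measure zero. -/
theorem IsGraphDirected.measure_frontier_eq_zero (h : IsGraphDirected N M J R) (hN : IsUnit N)
    (hcontr : ∀ ε : ℝ, 0 < ε → ∃ k : ℕ, ∀ x : E, ‖(N ^ k) x‖ ≤ ε * ‖x‖)
    (hR : ∀ a, IsCompact (R a)) (hint : ∀ a, (interior (R a)).Nonempty)
    (hM : (M.map (Nat.cast : ℕ → ℝ)).IsPrimitive) {β : ℝ} (hβ : 0 < β)
    (hdet : |LinearMap.det N| = 1 / β) {y : A → ℝ} (hy : ∀ a, 0 < y a)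
    (hyM : Matrix.vecMul y (M.map (Nat.cast : ℕ → ℝ)) = β • y) (a : A) :
    μ (frontier (R a)) = 0 := by
  set m : A → ℝ := fun b => μ.real (frontier (R b)) with hm
  -- Subinvariance reads `β m ≤ M m`; the left eigenvector turns it into an equality.
  have heig : (M.map (Nat.cast : ℕ → ℝ)).mulVec m = β • m := by
    refine eq_of_le_of_left_eigenvector hy hyM fun a => ?_
    have h1 := (h.measure_frontier_le μ hN hR a).1
    rw [hdet, one_div, ← div_eq_inv_mul, le_div_iff₀ hβ, mul_comm] at h1
    exact h1
  have hm0 : m = 0 := by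
    by_contra hne
    have hpos := pos_of_nonneg_eigenvector hM heig (fun b => measureReal_nonneg) hne
    obtain ⟨x, hx⟩ := hint a
    obtain ⟨ε, hε, hball⟩ := Metric.isOpen_iff.1 isOpen_interior x hx
    obtain ⟨ρ, hρ0, hρ⟩ := exists_norm_le_of_isCompact hR
    obtain ⟨k, hk⟩ := hcontr (ε / (4 * ρ)) (by positivity)
    obtain ⟨Jk, hJk⟩ := h.pow k
    obtain ⟨b, c, hc, y, hy, rfl⟩ := hJk.mem_iff.1 (_root_.interior_subset hx)
    -- The copy of level `k` through `x` fits in the ball around `x`, hence in the interior.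
    -- Omitting it gives `m a ≤ m a - β^(-k) m b`, with `m b > 0`.
    have h1 := (hJk.measure_frontier_le μ (hN.pow k) hR a).2 b c hc (by
      rintro _ ⟨z, hz, rfl⟩
      refine hball ?_
      rw [Metric.mem_ball, dist_add_right, dist_eq_norm, ← map_sub]
      have h1 : ‖z - y‖ ≤ 2 * ρ := by
        have := norm_sub_le z y
        linarith [hρ b y hy, hρ b z hz]
      calc ‖(N ^ k) (z - y)‖ ≤ ε / (4 * ρ) * ‖z - y‖ := hk _
        _ ≤ ε / (4 * ρ) * (2 * ρ) := mul_le_mul_of_nonneg_left h1 (by positivity)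
        _ = ε / 2 := by field_simp; norm_num
        _ < ε := by linarith)
    have h2 : ∑ e, ((M ^ k) a e : ℝ) * m e = β ^ k * m a := by
      have h3 := congrFun (pow_mulVec_eigenvector heig k) a
      have h4 : (M ^ k).map (Nat.cast : ℕ → ℝ) = (M.map (Nat.cast : ℕ → ℝ)) ^ k :=
        map_pow (Nat.castRingHom ℝ).mapMatrix M k
      rw [← h4] at h3
      exact h3
    rw [map_pow, abs_pow, hdet, h2, mul_sub, ← mul_assoc, ← mul_pow, one_div,
      inv_mul_cancel₀ hβ.ne', one_pow, one_mul] at h1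
    have h4 : 0 < β⁻¹ ^ k * m b := mul_pos (by positivity) (hpos b)
    simp only [hm] at h4
    linarith
  have h1 : μ.real (frontier (R a)) = 0 := congrFun hm0 a
  rw [measureReal_def, ENNReal.toReal_eq_zero_iff] at h1
  exact h1.resolve_right (measure_ne_top_of_subset_isCompact μ (hR a)
    (hR a).isClosed.frontier_subset)

end GraphDirected

/-! ### Disjointness in measure. -/

section Disjoint

/-- If the measure of a finite union of compact sets is the sum of the measures then the sets are
pairwise disjoint up to measure zero. -/
theorem aedisjoint_of_sum_le {X ι : Type*} [TopologicalSpace X] [T2Space X] [MeasurableSpace X]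
    [BorelSpace X] (μ : Measure X) [IsFiniteMeasureOnCompacts μ] (S : Finset ι) {f : ι → Set X}
    (hf : ∀ i, IsCompact (f i)) (h : ∑ i ∈ S, μ.real (f i) ≤ μ.real (⋃ i ∈ S, f i)) {i j : ι}
    (hi : i ∈ S) (hj : j ∈ S) (hij : i ≠ j) : AEDisjoint μ (f i) (f j) := by
  classical
  have htop : ∀ i, μ (f i) ≠ ⊤ := fun i => (hf i).measure_lt_top.ne
  have hj' : j ∈ S.erase i := Finset.mem_erase.2 ⟨hij.symm, hj⟩
  -- Keeping `f i ∪ f j` together makes the union bound fall short of the full sum by the measure of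
  -- `f i ∩ f j`.
  have h1 : ⋃ k ∈ S, f k ⊆ (f i ∪ f j) ∪ ⋃ k ∈ (S.erase i).erase j, f k := by
    refine Set.iUnion₂_subset fun k hk x hx => ?_
    by_cases hki : k = i
    · subst hki; exact Or.inl (Or.inl hx)
    by_cases hkj : k = j
    · subst hkj; exact Or.inl (Or.inr hx)
    · exact Or.inr (Set.mem_iUnion₂.2 ⟨k, by simp [hki, hkj, hk], hx⟩)
  have hc1 : IsCompact (f i ∪ f j) := (hf i).union (hf j)
  have hc2 : IsCompact (⋃ k ∈ (S.erase i).erase j, f k) :=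
    Finset.isCompact_biUnion _ fun k _ => hf k
  have h2 := measureReal_mono h1 (μ := μ) (hc1.union hc2).measure_lt_top.ne
  have h3 := measureReal_union_le (μ := μ) (f i ∪ f j) (⋃ k ∈ (S.erase i).erase j, f k)
  have h4 : μ.real (⋃ k ∈ (S.erase i).erase j, f k) ≤ ∑ k ∈ (S.erase i).erase j, μ.real (f k) :=
    measureReal_biUnion_finset_le _ _
  have h5 := measureReal_union_add_inter (μ := μ) (s := f i) (hf j).measurableSet (htop i) (htop j)
  have h6 := Finset.add_sum_erase S (fun k => μ.real (f k)) hi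
  have h7 := Finset.add_sum_erase (S.erase i) (fun k => μ.real (f k)) hj'
  have h8 : μ.real (f i ∩ f j) ≤ 0 := by linarith
  have h9 : μ.real (f i ∩ f j) = 0 := le_antisymm h8 measureReal_nonneg
  rw [measureReal_def, ENNReal.toReal_eq_zero_iff] at h9
  exact h9.resolve_right (measure_ne_top_of_subset_isCompact μ (hf i) Set.inter_subset_left)

variable {A : Type*} [Fintype A] [DecidableEq A] {σ : Substitution A}
  {E : Type*} [NormedAddCommGroup E] [NormedSpace ℝ E] [FiniteDimensional ℝ E]
  [MeasurableSpace E] [BorelSpace E] (μ : Measure E) [μ.IsAddHaarMeasure]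

/-- Each copy of `R b` has measure `μ(R b) / β`, and at most `M a b` of them occur in `R a`. So `β r
≤ M r` for the vector `r` of the measures; the pairing with `y` makes it an equality, which leaves
no room for overlaps. -/
theorem aedisjoint_pieces {N : Module.End ℝ E} {V : (A → ℝ) →ₗ[ℝ] E} {R : A → Set E}
    (hR : ∀ a, IsCompact (R a))
    (hdec : ∀ a, R a = ⋃ x ∈ {x : A × (A → ℝ) | σ.Transition x.1 x.2 a},
      (fun y => N y + V x.2) '' R x.1) {β : ℝ} (hβ : 0 < β) (hdet : |LinearMap.det N| = 1 / β)
    {y : A → ℝ} (hy : ∀ a, 0 < y a) (hyM : Matrix.vecMul y σ.realMatrix = β • y) (a : A) :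
    {x : A × (A → ℝ) | σ.Transition x.1 x.2 a}.Pairwise fun x x' =>
      AEDisjoint μ ((fun y => N y + V x.2) '' R x.1) ((fun y => N y + V x'.2) '' R x'.1) := by
  classical
  set f : A × (A → ℝ) → Set E := fun x => (fun y => N y + V x.2) '' R x.1 with hf
  have hfc : ∀ x, IsCompact (f x) := fun x =>
    (hR x.1).image (N.continuous_of_finiteDimensional.add continuous_const)
  set S : A → Finset (A × (A → ℝ)) := fun a =>
    Finset.univ.biUnion fun b => (σ.transitions b a).image fun t => (b, t) with hS
  have hmem : ∀ a x, x ∈ S a ↔ σ.Transition x.1 x.2 a := by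
    rintro a ⟨b, t⟩
    simp [hS, Substitution.mem_transitions]
  have hunion : ∀ a, R a = ⋃ x ∈ S a, f x := fun a => by
    rw [hdec a]
    simp only [hmem, hf]
    rfl
  set r : A → ℝ := fun a => μ.real (R a)
  have hsum : ∀ a, β * ∑ x ∈ S a, μ.real (f x) ≤ (σ.realMatrix.mulVec r) a := by
    intro a
    have h1 : ∀ x, μ.real (f x) = β⁻¹ * r x.1 := fun x => by
      rw [hf, measureReal_affine_image, hdet, one_div]
    simp only [h1, ← Finset.mul_sum, ← mul_assoc]
    rw [mul_inv_cancel₀ hβ.ne', one_mul, hS, Finset.sum_biUnion]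
    · refine Finset.sum_le_sum fun b _ => ?_
      rw [Finset.sum_image (fun _ _ _ _ h => (Prod.ext_iff.1 h).2)]
      simp only [Finset.sum_const, nsmul_eq_mul]
      refine mul_le_mul_of_nonneg_right ?_ measureReal_nonneg
      exact Nat.cast_le.2 (σ.card_transitions_le b a)
    · intro b _ b' _ hne
      rw [Function.onFun, Finset.disjoint_left]
      rintro ⟨e, c⟩ h1 h2
      simp only [Finset.mem_image, Prod.mk.injEq] at h1 h2
      obtain ⟨_, _, rfl, _⟩ := h1
      obtain ⟨_, _, rfl, _⟩ := h2
      exact hne rfl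
  have heig : σ.realMatrix.mulVec r = β • r := by
    refine eq_of_le_of_left_eigenvector hy hyM fun a => ?_
    refine le_trans (mul_le_mul_of_nonneg_left ?_ hβ.le) (hsum a)
    simp only [r]
    rw [hunion a]
    exact measureReal_biUnion_finset_le _ _
  intro x hx x' hx' hne
  refine aedisjoint_of_sum_le μ (S a) hfc ?_ ((hmem a x).2 hx) ((hmem a x').2 hx') hne
  rw [← hunion a]
  have := hsum a
  rw [heig] at this
  exact le_of_mul_le_mul_left this hβ

end Disjoint

/-! ### The self-replicating covering and non-empty interior. -/

section Interior

open Matrix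
open scoped Pointwise

theorem exists_le_le_succ {f : ℕ → ℝ} {s : ℝ} {n : ℕ} (h0 : f 0 ≤ s) (hn : s ≤ f n)
    (hpos : 0 < n) : ∃ j < n, f j ≤ s ∧ s ≤ f (j + 1) := by
  induction n with
  | zero => exact absurd hpos (lt_irrefl 0)
  | succ n ih =>
    rcases Nat.eq_zero_or_pos n with rfl | hpos'
    · exact ⟨0, by omega, h0, hn⟩
    · rcases le_total s (f n) with h | h
      · obtain ⟨j, hj, hj'⟩ := ih h hpos'
        exact ⟨j, by omega, hj'⟩
      · exact ⟨n, by omega, h, hn⟩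

variable {A : Type*} [Fintype A] {E : Type*} [NormedAddCommGroup E] [NormedSpace ℝ E]

/-- The translations of the piece of index `a` in the self-replicating covering. -/
def stripPoints (y : A → ℝ) (V : (A → ℝ) →ₗ[ℝ] E) (a : A) : Set E :=
  {e | ∃ x : A → ℤ, V (fun b => (x b : ℝ)) = e ∧ 0 ≤ (y ⬝ᵥ fun b => (x b : ℝ)) ∧
    (y ⬝ᵥ fun b => (x b : ℝ)) ≤ y a}

variable {y : A → ℝ} {V : (A → ℝ) →ₗ[ℝ] E} {N : Module.End ℝ E} {R : A → Set E} {β : ℝ}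

theorem countable_stripPoints (a : A) : (stripPoints y V a).Countable :=
  (Set.countable_range fun x : A → ℤ => V fun b => (x b : ℝ)).mono
    (by rintro _ ⟨x, rfl, -⟩; exact ⟨x, rfl⟩)

theorem isClosed_stripPoints
    (hfin : ∀ c r : ℝ, {e : E | ∃ x : A → ℤ, V (fun a => (x a : ℝ)) = e ∧
      |y ⬝ᵥ fun a => (x a : ℝ)| ≤ c ∧ ‖e‖ ≤ r}.Finite) (a : A) :
    IsClosed (stripPoints y V a) := by
  refine isClosed_of_closure_subset fun z hz => ?_
  have h1 : (Metric.ball z 1 ∩ stripPoints y V a).Finite := by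
    refine (hfin (y a) (‖z‖ + 1)).subset ?_
    rintro _ ⟨hb, ⟨x, rfl, hx0, hx1⟩⟩
    refine ⟨x, rfl, ?_, ?_⟩
    · rwa [abs_of_nonneg hx0]
    · rw [mem_ball_iff_norm] at hb
      have := norm_sub_norm_le (V fun b => (x b : ℝ)) z
      linarith
  have h2 := Metric.isOpen_ball.inter_closure ⟨Metric.mem_ball_self one_pos, hz⟩
  rw [h1.isClosed.closure_eq] at h2
  exact h2.2

variable [DecidableEq A] {σ : Substitution A}

/-- The union of the translated pieces is stable by `N`: dual substitution. -/
theorem map_mem_covering (hN : N ∘ₗ V = V ∘ₗ σ.incidenceEnd)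
    (hdec : ∀ a, R a = ⋃ x ∈ {x : A × (A → ℝ) | σ.Transition x.1 x.2 a},
      (fun y => N y + V x.2) '' R x.1) (hβ : 0 < β)
    (hyM : y ᵥ* σ.realMatrix = β • y) {p : E}
    (hp : p ∈ ⋃ a, R a + stripPoints y V a) : N p ∈ ⋃ a, R a + stripPoints y V a := by
  obtain ⟨b, q, hq, _, ⟨x, rfl, hx0, hx1⟩, rfl⟩ := Set.mem_iUnion.1 hp
  have hM : ∀ z, y ⬝ᵥ σ.incidenceEnd z = β * (y ⬝ᵥ z) := fun z => by
    have := dotProduct_aeval hyM X z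
    rwa [aeval_X, eval_X] at this
  set f : ℕ → ℝ := fun j => y ⬝ᵥ ab ((σ.image b).take j)
  -- The weights `f` of the prefixes of `σ(b)` go from `0` to `β y_b`, and `β (y · x)` lies between.
  -- Cutting where it is crossed gives a prefix `p` followed by a letter `a`, and `x' = M x - ab(p)`
  -- satisfies `0 ≤ y · x' ≤ y_a`.
  obtain ⟨j, hj, hj0, hj1⟩ := exists_le_le_succ (f := f)
    (s := β * (y ⬝ᵥ fun b => (x b : ℝ))) (n := (σ.image b).length)
    (by simp only [f, List.take_zero, ab_nil, dotProduct_zero]; positivity)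
    (by
      simp only [f, List.take_length]
      rw [σ.ab_image, hM, dotProduct_single_one]
      exact mul_le_mul_of_nonneg_left hx1 hβ.le) (σ.length_image_pos b)
  set a := (σ.image b)[j]
  have hsplit : (σ.image b).take (j + 1) = (σ.image b).take j ++ [a] := by
    rw [List.take_succ_eq_append_getElem hj]
  have hT : σ.Transition b (ab ((σ.image b).take j)) a :=
    ⟨_, (σ.image b).drop (j + 1), by rw [List.getElem_cons_drop, List.take_append_drop], rfl⟩
  have hmem : N q + V (ab ((σ.image b).take j)) ∈ R a := by
    rw [hdec a]
    exact Set.mem_iUnion₂.2 ⟨(b, ab ((σ.image b).take j)), hT, q, hq, rfl⟩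
  let x' : A → ℤ := fun c => (∑ e, (σ.incidence c e : ℤ) * x e) - ((σ.image b).take j).count c
  have hx' : (fun c => (x' c : ℝ)) =
      σ.incidenceEnd (fun c => (x c : ℝ)) - ab ((σ.image b).take j) := by
    funext c
    simp [x', Substitution.incidenceEnd, mulVec, dotProduct, ab]
  have hy' : (y ⬝ᵥ fun c => (x' c : ℝ)) = β * (y ⬝ᵥ fun b => (x b : ℝ)) - f j := by
    rw [hx', dotProduct_sub, hM]
  have hf1 : f (j + 1) = f j + y a := by
    simp only [f]
    rw [hsplit, ab_append, dotProduct_add, ab_singleton, dotProduct_single_one]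
  refine Set.mem_iUnion.2 ⟨a, _, hmem, _, ⟨x', rfl, ?_, ?_⟩, ?_⟩
  · rw [hy']; linarith
  · rw [hy']; linarith
  · have h1 := LinearMap.congr_fun hN (fun c => (x c : ℝ))
    simp only [LinearMap.comp_apply] at h1
    simp only [hx', map_sub, map_add, h1]
    abel

variable [FiniteDimensional ℝ E]

/-- The covering by the translated pieces is relatively dense. -/
theorem exists_covering_near (hy : ∀ a, 0 < y a) (hV : Function.Surjective V) {w : A → ℝ}
    (hw : V w = 0) (hyw : y ⬝ᵥ w ≠ 0) {a : A} (ha : (R a).Nonempty) :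
    ∃ ρ : ℝ, 0 ≤ ρ ∧ ∀ z : E, ∃ p ∈ ⋃ a, R a + stripPoints y V a, ‖p - z‖ ≤ ρ := by
  obtain ⟨q, hq⟩ := ha
  obtain ⟨g, hg⟩ := V.exists_rightInverse_of_surjective (LinearMap.range_eq_top.2 hV)
  let V' := LinearMap.toContinuousLinearMap V
  set Y : ℝ := ∑ b, y b
  have hY : 0 ≤ Y := Finset.sum_nonneg fun b _ => (hy b).le
  set K : ℝ := Y / y a + 1
  have hK : 0 ≤ K := by have := hy a; positivity
  refine ⟨‖q‖ + ‖V'‖ * (1 + K), by positivity, fun z => ?_⟩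
  -- `ξ` is the lift of `z` orthogonal to `y`, obtained by correcting along `w ∈ ker V`. Rounding it
  -- down makes the weight non-positive, and adding `n` times the basis vector of `a` brings the
  -- weight into `[0, y_a]`.
  set ξ : A → ℝ := g z - ((y ⬝ᵥ g z) / (y ⬝ᵥ w)) • w with hξ
  have hξV : V ξ = z := by
    rw [hξ, map_sub, map_smul, hw, smul_zero, sub_zero, ← LinearMap.comp_apply, hg,
      LinearMap.id_apply]
  have hξy : y ⬝ᵥ ξ = 0 := by
    rw [hξ, dotProduct_sub, dotProduct_smul, smul_eq_mul, div_mul_cancel₀ _ hyw, sub_self]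
  set φ : A → ℝ := fun b => Int.fract (ξ b) with hφ
  have hφ0 : ∀ b, 0 ≤ φ b := fun b => Int.fract_nonneg _
  have hφ1 : ∀ b, φ b ≤ 1 := fun b => (Int.fract_lt_one _).le
  have hyφ0 : 0 ≤ y ⬝ᵥ φ := Finset.sum_nonneg fun b _ => mul_nonneg (hy b).le (hφ0 b)
  have hyφ1 : y ⬝ᵥ φ ≤ Y := Finset.sum_le_sum fun b _ => mul_le_of_le_one_right (hy b).le (hφ1 b)
  set n : ℤ := ⌈(y ⬝ᵥ φ) / y a⌉
  have hn0 : (y ⬝ᵥ φ) ≤ n * y a := (div_le_iff₀ (hy a)).1 (Int.le_ceil _)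
  have hn1 : (n : ℝ) < (y ⬝ᵥ φ) / y a + 1 := Int.ceil_lt_add_one _
  have hn2 : (n : ℝ) * y a ≤ y ⬝ᵥ φ + y a := by
    have := mul_le_mul_of_nonneg_right hn1.le (hy a).le
    rwa [add_mul, one_mul, div_mul_cancel₀ _ (hy a).ne'] at this
  have hnn : (0 : ℝ) ≤ n := by
    have : (0 : ℤ) ≤ n := Int.ceil_nonneg (div_nonneg hyφ0 (hy a).le)
    exact_mod_cast this
  have hnK : (n : ℝ) ≤ K := hn1.le.trans (by
    have := div_le_div_of_nonneg_right hyφ1 (hy a).le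
    simp only [K]; linarith)
  let x : A → ℤ := fun b => ⌊ξ b⌋ + n * (Pi.single a 1 : A → ℤ) b
  have hx : (fun b => (x b : ℝ)) = ξ - φ + (n : ℝ) • Pi.single a 1 := by
    funext b
    by_cases h : b = a
    · subst h
      simp [x, hφ]
    · simp [x, hφ, h]
  have hyx : (y ⬝ᵥ fun b => (x b : ℝ)) = - (y ⬝ᵥ φ) + n * y a := by
    rw [hx, dotProduct_add, dotProduct_sub, hξy, dotProduct_smul, dotProduct_single_one,
      smul_eq_mul, zero_sub]
  refine ⟨q + V (fun b => (x b : ℝ)), Set.mem_iUnion.2 ⟨a, q, hq, _, ⟨x, rfl, ?_, ?_⟩, rfl⟩, ?_⟩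
  · rw [hyx]; linarith
  · rw [hyx]; linarith
  · have h1 : q + V (fun b => (x b : ℝ)) - z = q + V' (-φ + (n : ℝ) • Pi.single a 1) := by
      change _ = q + V (-φ + (n : ℝ) • Pi.single a 1)
      rw [hx, map_add, map_sub, map_add, map_neg, hξV]
      abel
    rw [h1]
    refine (norm_add_le _ _).trans (add_le_add le_rfl ((V'.le_opNorm _).trans
      (mul_le_mul_of_nonneg_left ((norm_add_le _ _).trans (add_le_add ?_ ?_)) (norm_nonneg _))))
    · rw [norm_neg]
      refine (pi_norm_le_iff_of_nonneg zero_le_one).2 fun b => ?_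
      rw [Real.norm_of_nonneg (hφ0 b)]
      exact hφ1 b
    · rw [norm_smul, Real.norm_of_nonneg hnn]
      refine (mul_le_of_le_one_right hnn ?_).trans hnK
      refine (pi_norm_le_iff_of_nonneg zero_le_one).2 fun b => ?_
      by_cases h : b = a
      · subst h; simp
      · simp [h]

/-- One of the pieces has non-empty interior: a countable union of translated pieces covers the
space. -/
theorem exists_interior_nonempty (hR : ∀ a, IsCompact (R a))
    (hfin : ∀ c r : ℝ, {e : E | ∃ x : A → ℤ, V (fun a => (x a : ℝ)) = e ∧
      |y ⬝ᵥ fun a => (x a : ℝ)| ≤ c ∧ ‖e‖ ≤ r}.Finite)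
    (hNu : IsUnit N) (hN : N ∘ₗ V = V ∘ₗ σ.incidenceEnd)
    (hcontr : ∀ ε : ℝ, 0 < ε → ∃ k : ℕ, ∀ x : E, ‖(N ^ k) x‖ ≤ ε * ‖x‖)
    (hdec : ∀ a, R a = ⋃ x ∈ {x : A × (A → ℝ) | σ.Transition x.1 x.2 a},
      (fun y => N y + V x.2) '' R x.1) (hβ : 0 < β)
    (hy : ∀ a, 0 < y a) (hyM : y ᵥ* σ.realMatrix = β • y) (hV : Function.Surjective V)
    {w : A → ℝ} (hw : V w = 0) (hyw : y ⬝ᵥ w ≠ 0) {a : A} (ha : (R a).Nonempty) :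
    ∃ b, (interior (R b)).Nonempty := by
  set U : Set E := ⋃ a, R a + stripPoints y V a with hU
  have hclosed : IsClosed U := isClosed_iUnion_of_finite fun a =>
    (isClosed_stripPoints hfin a).add_left_of_isCompact (hR a)
  obtain ⟨ρ, hρ0, hρ⟩ := exists_covering_near (R := R) hy hV hw hyw ha
  have hpow : ∀ (k : ℕ) (p : E), p ∈ U → (N ^ k) p ∈ U := by
    intro k
    induction k with
    | zero => exact fun p hp => hp
    | succ k ih =>
      intro p hp
      rw [pow_succ', Module.End.mul_apply]
      exact map_mem_covering hN hdec hβ hyM (ih p hp)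
  -- `U` contains `N^k U`, and the image of a relatively dense set by a surjective contraction is
  -- `ε`-dense for `k` large.
  have huniv : U = Set.univ := by
    refine Set.eq_univ_of_forall fun z => ?_
    rw [← hclosed.closure_eq, Metric.mem_closure_iff]
    intro ε hε
    obtain ⟨k, hk⟩ := hcontr (ε / (2 * (ρ + 1))) (by positivity)
    obtain ⟨z', rfl⟩ := ((Module.End.isUnit_iff _).1 (hNu.pow k)).2 z
    obtain ⟨p, hp, hpz⟩ := hρ z'
    refine ⟨_, hpow k p hp, ?_⟩
    rw [dist_comm, dist_eq_norm, ← map_sub]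
    calc ‖(N ^ k) (p - z')‖ ≤ ε / (2 * (ρ + 1)) * ‖p - z'‖ := hk _
      _ ≤ ε / (2 * (ρ + 1)) * (ρ + 1) :=
        mul_le_mul_of_nonneg_left (by linarith) (by positivity)
      _ = ε / 2 := by field_simp
      _ < ε := by linarith
  have hcount : ∀ a, Countable (stripPoints y V a) := fun a => countable_stripPoints a
  have hcov : ⋃ q : Σ a, stripPoints y V a, (Homeomorph.addRight (q.2 : E)) '' R q.1 =
      Set.univ := by
    rw [← huniv]
    ext e
    simp only [hU, Set.mem_iUnion, Set.mem_image, Set.mem_add]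
    constructor
    · rintro ⟨⟨a, t⟩, p, hp, rfl⟩
      exact ⟨a, p, hp, t, t.2, rfl⟩
    · rintro ⟨a, p, hp, t, ht, rfl⟩
      exact ⟨⟨a, t, ht⟩, p, hp, rfl⟩
  have := FiniteDimensional.complete ℝ E
  obtain ⟨q, hq⟩ := nonempty_interior_of_iUnion_of_closed (fun q : Σ a, stripPoints y V a =>
    (Homeomorph.addRight (q.2 : E)).isClosedMap _ (hR q.1).isClosed) hcov
  rw [← Homeomorph.image_interior] at hq
  exact ⟨q.1, hq.of_image⟩

end Interior

theorem isGraphDirected_of_transitions {A : Type*} [DecidableEq A] {σ : Substitution A}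
    {E : Type*} [NormedAddCommGroup E] [NormedSpace ℝ E] {V : (A → ℝ) →ₗ[ℝ] E}
    {N : Module.End ℝ E} {R : A → Set E}
    (hdec : ∀ a, R a = ⋃ x ∈ {x : A × (A → ℝ) | σ.Transition x.1 x.2 a},
      (fun y => N y + V x.2) '' R x.1) :
    ∃ J : A → A → Finset E, IsGraphDirected N σ.incidence J R := by
  classical
  refine ⟨fun b a => (σ.transitions b a).image V,
    ⟨fun b a => Finset.card_image_le.trans (σ.card_transitions_le b a), fun b a h => ?_,
      fun a => ?_⟩⟩
  · obtain ⟨p, s, hps⟩ := List.append_of_mem (List.count_pos_iff.1 h)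
    exact ⟨_, Finset.mem_image_of_mem V (Substitution.mem_transitions.2 ⟨p, s, hps, rfl⟩)⟩
  · rw [hdec a]
    ext x
    simp only [Set.mem_iUnion, Finset.mem_image, Substitution.mem_transitions, exists_prop,
      Set.mem_ofPred_eq, Prod.exists]
    constructor
    · rintro ⟨b, t, ht, hx⟩
      exact ⟨b, _, ⟨t, ht, rfl⟩, hx⟩
    · rintro ⟨b, _, ⟨t, ht, rfl⟩, hx⟩
      exact ⟨b, t, ht, hx⟩

/-! ### Injectivity on worms, and the spectral properties of `V` and `q`. -/

section Conclusion

open Matrix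

variable {A : Type*} [Fintype A] [DecidableEq A] {σ : Substitution A} {β : ℝ} {y : A → ℝ}
  {E : Type*} [NormedAddCommGroup E] [NormedSpace ℝ E] {V : (A → ℝ) →ₗ[ℝ] E} {P : ℤ[X]}

/-- Two points of a worm differ, up to sign, by the abelianization of a factor, a non-negative
integer vector. If it lies in `ker V` it is zero, and the factor is empty. -/
theorem injOn_worm (hβQ : ∀ r : ℚ, (r : ℝ) ≠ β) (hy : ∀ a, 0 < y a)
    (hyM : y ᵥ* σ.realMatrix = β • y) (hPβ : (P.map (Int.castRingHom ℝ)).eval β ≠ 0)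
    (hV : LinearMap.ker V = LinearMap.ker (aeval σ.incidenceEnd (kerPolynomial β P)))
    (v : ℤ → A) : Set.InjOn V (worm v) := by
  have key : ∀ (m : ℤ) (n : ℕ), V (abPrefix v m) = V (abPrefix v (m + n)) → n = 0 := by
    intro m n h
    rw [abPrefix_add_natCast, map_add, left_eq_add] at h
    have h1 : ab (factor v m n) ∈ LinearMap.ker V := h
    rw [hV] at h1
    have h2 := eq_zero_of_mem_ker hβQ hy hyM hPβ (fun a => (factor v m n).count a) h1
    rw [← factor_length v m n, List.length_eq_zero_iff, List.eq_nil_iff_forall_not_mem]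
    intro a ha
    exact (List.count_pos_iff.2 ha).ne' (h2 a)
  rintro _ ⟨m, rfl⟩ _ ⟨n, rfl⟩ h
  rcases le_total m n with hmn | hmn
  · obtain ⟨k, rfl⟩ := Int.exists_add_of_le hmn
    rw [key m k h, Nat.cast_zero, add_zero]
  · obtain ⟨k, rfl⟩ := Int.exists_add_of_le hmn
    rw [key n k h.symm, Nat.cast_zero, add_zero]

theorem map_incidenceEnd_eq_zero
    (hV : LinearMap.ker V = LinearMap.ker (aeval σ.incidenceEnd (kerPolynomial β P))) (x : A → ℝ)
    (hx : V x = 0) : V (σ.incidenceEnd x) = 0 := by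
  have h1 : x ∈ LinearMap.ker V := hx
  have h2 : σ.incidenceEnd x ∈ LinearMap.ker V := by
    rw [hV, LinearMap.mem_ker] at h1 ⊢
    have h3 : aeval σ.incidenceEnd (kerPolynomial β P * X) x =
        aeval σ.incidenceEnd (X * kerPolynomial β P) x := by rw [mul_comm]
    rw [map_mul, map_mul, aeval_X, Module.End.mul_apply, Module.End.mul_apply, h1, map_zero] at h3
    exact h3
  exact h2

/-- The right Perron eigenvector is in the kernel of `V` and not orthogonal to the left one. -/
theorem exists_right_eigenvector (hσ : σ.IsPrimitive) (hβ : σ.IsPerronEigenvalue β)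
    (hβ0 : 0 ≤ β) (hy : ∀ a, 0 < y a) (hyM : y ᵥ* σ.realMatrix = β • y)
    (hV : LinearMap.ker V = LinearMap.ker (aeval σ.incidenceEnd (kerPolynomial β P))) :
    ∃ w, V w = 0 ∧ y ⬝ᵥ w ≠ 0 := by
  obtain ⟨w, hw⟩ := hβ.1.exists_hasEigenvector
  refine ⟨w, ?_, fun h => hw.2 (eigenvector_eq_zero hσ hβ0 hy hyM hw.apply_eq_smul h)⟩
  have h1 : w ∈ LinearMap.ker V := by
    rw [hV, LinearMap.mem_ker, Module.End.aeval_apply_of_hasEigenvector hw, kerPolynomial,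
      eval_mul, eval_sub, eval_X, eval_C, sub_self, zero_mul, zero_smul]
  exact h1

theorem norm_lt_one_of_isRoot (hPisot : IsPisot β) {q : ℝ[X]}
    (hq : (minpoly ℚ β).map (algebraMap ℚ ℝ) = (X - C β) * q) (hqβ : IsCoprime q (X - C β))
    (z : ℂ) (hz : (q.map Complex.ofRealHom).IsRoot z) : ‖z‖ < 1 := by
  have hint : IsIntegral ℚ β := hPisot.1.tower_top
  refine hPisot.2.2 z ?_ ?_
  · rw [mem_aroots]
    refine ⟨minpoly.ne_zero hint, ?_⟩
    have h1 : (minpoly ℚ β).map (algebraMap ℚ ℂ) =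
        ((minpoly ℚ β).map (algebraMap ℚ ℝ)).map Complex.ofRealHom := by
      rw [Polynomial.map_map]; congr 1
    rw [← eval_map_algebraMap, h1, hq, Polynomial.map_mul, eval_mul, IsRoot.def.1 hz, mul_zero]
  · rintro rfl
    have h2 : q.eval β = 0 := by
      have h3 : (q.map Complex.ofRealHom).eval (Complex.ofRealHom β) = 0 := hz
      rw [eval_map_apply] at h3
      exact Complex.ofReal_eq_zero.1 h3
    obtain ⟨a, b, hab⟩ := hqβ
    have := congrArg (eval β) hab
    simp [h2] at this

end Conclusion

end RauzyFractal

/-! ### The main theorem. -/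

theorem mainTheorem6 {A : Type*} [Fintype A] [DecidableEq A] [TopologicalSpace A]
    [DiscreteTopology A] (σ : RauzyFractal.Substitution A) (hσ : σ.IsPrimitive)
    (d : ℕ) (β : ℝ) (hβ : σ.IsPerronEigenvalue β) (hPisot : RauzyFractal.IsPisot β)
    (hunit : RauzyFractal.IsAlgebraicUnit β) (hdeg : (minpoly ℚ β).natDegree = d + 1)
    (u : ℤ → A) (hu : u ∈ σ.subshift) (hfix : σ.onBiinfinite u = u)
    (P : ℤ[X])
    (hP : (σ.incidence.map (Nat.cast : ℕ → ℚ)).charpoly =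
      minpoly ℚ β * P.map (Int.castRingHom ℚ))
    (V : (A → ℝ) →ₗ[ℝ] EuclideanSpace ℝ (Fin d))
    (hV : RauzyFractal.IsProjectionAlong V
      (LinearMap.ker ((σ.incidenceEnd - β • 1) * aeval σ.incidenceEnd P))) :
    -- the map `φ` is well defined on `Ω_σ`
    (ContinuousOn (RauzyFractal.rauzyMap V u) σ.subshift ∧
      ∀ n : ℤ, RauzyFractal.rauzyMap V u (RauzyFractal.shiftPow n u) =
        V (RauzyFractal.abPrefix u n)) ∧
    -- the map `N`, and the Lebesgue-disjoint union
    (∃ N : Module.End ℝ (EuclideanSpace ℝ (Fin d)),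
      N ∘ₗ V = V ∘ₗ σ.incidenceEnd ∧
      (∀ N' : Module.End ℝ (EuclideanSpace ℝ (Fin d)),
        N' ∘ₗ V = V ∘ₗ σ.incidenceEnd → N' = N) ∧
      IsUnit N ∧
      |LinearMap.det N| = 1 / β ∧
      ∀ a : A,
        (RauzyFractal.rauzyPiece σ V u a =
          ⋃ x ∈ {x : A × (A → ℝ) | σ.Transition x.1 x.2 a},
            (fun y => N y + V x.2) '' RauzyFractal.rauzyPiece σ V u x.1) ∧
        {x : A × (A → ℝ) | σ.Transition x.1 x.2 a}.Pairwise fun x x' =>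
          AEDisjoint volume
            ((fun y => N y + V x.2) '' RauzyFractal.rauzyPiece σ V u x.1)
            ((fun y => N y + V x'.2) '' RauzyFractal.rauzyPiece σ V u x'.1)) ∧
    -- injectivity on worms
    (∀ v : ℤ → A, Set.InjOn V (RauzyFractal.worm v)) ∧
    -- topology and boundary of the pieces
    ∀ a : A,
      RauzyFractal.rauzyPiece σ V u a = closure (interior (RauzyFractal.rauzyPiece σ V u a)) ∧
      volume (frontier (RauzyFractal.rauzyPiece σ V u a)) = 0 := by
  have hβ1 : 1 < β := hPisot.2.1
  have hβ0 : 0 < β := one_pos.trans hβ1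
  obtain ⟨y, hy, hyM⟩ := RauzyFractal.Substitution.exists_left_eigenvector hσ hβ hβ0.le
  have hPβ := RauzyFractal.Substitution.aeval_ne_zero hσ hβ0.le hP hy hyM
  have hVs := RauzyFractal.surjective_of_isProjectionAlong hV
  have hker : LinearMap.ker V =
      LinearMap.ker (aeval σ.incidenceEnd (RauzyFractal.kerPolynomial β P)) := by
    rw [hV.1, RauzyFractal.aeval_kerPolynomial]
  obtain ⟨N, hN⟩ := RauzyFractal.exists_quotient_map hVs σ.incidenceEnd
    (RauzyFractal.map_incidenceEnd_eq_zero hker)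
  obtain ⟨q, hq, hqm, hqs, hqβ, hqd⟩ := RauzyFractal.exists_conjugate_factor hPisot.1
  have hchar : N.charpoly = q := by
    refine RauzyFractal.charpoly_quotient σ.realMatrix (K := RauzyFractal.kerPolynomial β P) ?_ hqm
      hqs (RauzyFractal.isCoprime_conjugate_factor hPisot.1 hPβ hq hqβ) ?_ hVs hker hN
    · rw [RauzyFractal.Substitution.charpoly_realMatrix hP, hq, RauzyFractal.kerPolynomial]
      ring
    · rw [finrank_euclideanSpace, Fintype.card_fin]
      omega
  have hdet := RauzyFractal.det_eq_of_charpoly N hchar hq hunit hβ0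
  have hNu : IsUnit N := by
    rw [LinearMap.isUnit_iff_isUnit_det, isUnit_iff_ne_zero]
    intro h0
    rw [h0, abs_zero] at hdet
    exact (one_div_pos.2 hβ0).ne hdet
  have hcontr : ∀ ε : ℝ, 0 < ε → ∃ k : ℕ, ∀ x, ‖(N ^ k) x‖ ≤ ε * ‖x‖ := fun ε hε =>
    RauzyFractal.exists_pow_contracting N (fun z hz =>
      RauzyFractal.norm_lt_one_of_isRoot hPisot hq hqβ z (hchar ▸ hz)) hε
  obtain ⟨k, hk⟩ := hcontr (1 / 2) (by norm_num)
  obtain ⟨R, hR⟩ := RauzyFractal.exists_bound_abPrefix hfix hN hk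
  have hmin : ∀ v ∈ σ.subshift, u ∈ closure (Set.range fun n : ℤ => RauzyFractal.shiftPow n v) :=
    fun v hv => RauzyFractal.mem_closure_orbit hσ hβ1 hy hyM hu hfix hv
  have hcpt := RauzyFractal.isCompact_rauzyPiece hR hmin hfix
  have hdec := RauzyFractal.rauzyPiece_eq hR hmin hfix hu hN
  obtain ⟨J, hJ⟩ := RauzyFractal.isGraphDirected_of_transitions hdec
  obtain ⟨w, hw, hyw⟩ := RauzyFractal.exists_right_eigenvector hσ hβ hβ0.le hy hyM hker
  obtain ⟨b, hb⟩ := RauzyFractal.exists_interior_nonempty hcpt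
    (RauzyFractal.finite_image_strip hσ hβ0.le hy hyM hker) hNu hN hcontr hdec hβ0 hy hyM hVs hw
    hyw (a := u 0) ⟨_, u, ⟨hu, rfl⟩, rfl⟩
  obtain ⟨m, -, hm⟩ := hσ.exists_pos_pow
  have hm' : ∀ a b, 0 < (σ.incidence ^ m) a b := fun a b => by
    have h1 : (σ.incidence ^ m).map (Nat.cast : ℕ → ℝ) = (σ.incidence.map (Nat.cast : ℕ → ℝ)) ^ m :=
      map_pow (Nat.castRingHom ℝ).mapMatrix σ.incidence m
    have h2 := hm a b
    rw [← h1, Matrix.map_apply] at h2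
    exact_mod_cast h2
  have hint := hJ.interior_nonempty hNu hm' hb
  refine ⟨⟨RauzyFractal.continuousOn_rauzyMap hR hmin hfix,
    RauzyFractal.rauzyMap_orbit hR hmin hfix hu⟩, ⟨N, hN, fun N' hN' => ?_, hNu, hdet, fun a =>
    ⟨hdec a, RauzyFractal.aedisjoint_pieces volume hcpt hdec hβ0 hdet hy hyM a⟩⟩,
    RauzyFractal.injOn_worm (RauzyFractal.not_mem_range_of_pisot_unit hPisot hunit) hy hyM hPβ hker,
    fun a => ⟨hJ.eq_closure_interior hNu hcontr hcpt hint a,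
      hJ.measure_frontier_eq_zero volume hNu hcontr hcpt hint hσ hβ0 hdet hy hyM a⟩⟩
  refine LinearMap.ext fun e => ?_
  obtain ⟨x, rfl⟩ := hVs e
  exact LinearMap.congr_fun (hN'.trans hN.symm) x
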